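/- **Conventions.** $\{0,1\}^m$ is the set of bit strings of length $m$, and a string $x$ is identified with the density operator $|x\rangle\langle x|$; $\varepsilon$ is the empty string. A *gate set* $\mathcal G$ is a finite set of channels, each of which is a conjugation $L\mapsto ULU^\dagger$ by a unitary $U$ on finitely many qubits with algebraic entries in the computational basis, the preparation $c\mapsto c\,|0\rangle\langle 0|$ of one qubit, or the trace of one qubit. A *circuit* built from $\mathcal G$ is a finite composition of layers, each layer being a finite tensor product of elements of $\mathcal G$; it is an $(a,b)$-circuit if it implements a channel from $a$ qubits to $b$ qubits. For $a,b:\mathbb N\to\mathbb N$, an $(a,b)$-circuit family is a sequence $(C_n)_{n\in\mathbb N}$ of $(a(n),b(n))$-circuits $C_n$ built from one gate set. It is *uniform* if some deterministic Turing machine, on input $1^n$, outputs a description of $C_n$ (the list of the layers of $C_n$ and of the gates in each layer, in a fixed encoding by bit strings), and *exponential-time* if this machine halts within $2^{r(n)}$ steps for some polynomial $r$. Let $\ell:\mathbb N\to\mathbb N$. An *$\ell$-sequence* is a sequence $(s_n)_{n\in\mathbb N}$ with $s_n\in\{0,1\}^{\ell(n)}$ for all $n$. It is *computably* (respectively, *exponential-time*)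 *ingenerable* if for every gate set $\mathcal G$ there is a polynomial $p_{\mathcal G}:\mathbb N\to\mathbb R$ such that for every uniform (respectively, exponential-time) $(0,\ell)$-circuit family $(D_n)_{n\in\mathbb N}$ built from $\mathcal G$ one has $\langle s_n|D_n(\varepsilon)|s_n\rangle<p_{\mathcal G}(n)\,2^{-\ell(n)}$ for all but finitely many $n$. A function $f:\mathbb N\to\mathbb R$ is *negligible* if for every $c\in\mathbb N$ one has $f(n)\le n^{-c}$ for all sufficiently large $n$. **Theorem.** Let $(s_n)_{n\in\mathbb N}$ be a computably (respectively, exponential-time) ingenerable $\ell$-sequence, where $\ell:\mathbb N\to\mathbb N$ is arbitrary (respectively, $\ell\in\mathcal O(n^k)$ for some $k\in\mathbb N$). Then for every uniform (respectively, exponential-time) $(\ell,1)$-circuit family $(C_n)_{n\in\mathbb N}$, built from any gate set, there exists a polynomial $p$ such that for all sufficiently large $n$ (depending on the family) $$\langle 1|C_n(s_n)|1\rangle\;\le\;p(n)\cdot\Bigl(2^{-\ell(n)}+\mathop{\mathbb E}_{x\leftarrow\{0,1\}^{\ell(n)}}\langle 1|C_n(x)|1\rangle\Bigr),$$ where $x$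 is uniformly random. In particular, if $\ell\in\omega(\log)$ and $n\mapsto\mathbb E_{x\leftarrow\{0,1\}^{\ell(n)}}\langle 1|C_n(x)|1\rangle$ is negligible, then so is $n\mapsto\langle 1|C_n(s_n)|1\rangle$. -/

import Mathlib

open scoped Filter Asymptotics
open scoped BigOperators

noncomputable section

namespace QCirc

/-- Bit strings of length `n`; `false` is the bit `0` and `true` is the bit `1`. -/
abbrev Bits (n : ℕ) : Type := Fin n → Bool

/-- Linear operators on `n` qubits, as matrices in the computational basis. -/
abbrev Operator (n : ℕ) : Type := Matrix (Bits n) (Bits n) ℂ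

/-- Linear maps from operators on `a` qubits to operators on `b` qubits. -/
abbrev SuperOp (a b : ℕ) : Type := Operator a →ₗ[ℂ] Operator b

/-- The density operator `|x⟩⟨x|`. -/
def ketbra {n : ℕ} (x : Bits n) : Operator n := Matrix.single x x 1

/-- The first `a` qubits and the last `c` qubits of `a + c` qubits. -/
def splitBits (a c : ℕ) : Bits (a + c) ≃ Bits a × Bits c :=
  (Equiv.arrowCongr finSumFinEquiv.symm (Equiv.refl Bool)).trans
    (Equiv.sumArrowEquivProdArrow (Fin a) (Fin c) Bool)

/-- The identification of `L(H) ⊗ L(H')` with `L(H ⊗ H')` (Kronecker product). -/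
def operatorTensor (a c : ℕ) : TensorProduct ℂ (Operator a) (Operator c) ≃ₗ[ℂ] Operator (a + c) :=
  (kroneckerLinearEquiv (Bits a) (Bits a) (Bits c) (Bits c) ℂ).trans
    (Matrix.reindexLinearEquiv ℂ ℂ (splitBits a c).symm (splitBits a c).symm)

/-- The tensor product of two maps on operators. -/
def SuperOp.tensor {a b c d : ℕ} (Φ : SuperOp a b) (Ψ : SuperOp c d) : SuperOp (a + c) (b + d) :=
  (operatorTensor b d).toLinearMap ∘ₗ TensorProduct.map Φ Ψ ∘ₗ (operatorTensor a c).symm.toLinearMap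

/-- An elementary gate: a unitary with algebraic entries, the preparation of a qubit in the state
`|0⟩`, or the trace of a single qubit. -/
inductive Gate : Type
  | unitary (k : ℕ) (U : Operator k) (hU : U ∈ Matrix.unitaryGroup (Bits k) ℂ)
      (halg : ∀ x y, IsAlgebraic ℚ (U x y)) : Gate
  | prep : Gate
  | trace : Gate

/-- Number of input qubits of a gate. -/
@[reducible] def Gate.inputs : Gate → ℕ
  | .unitary k _ _ _ => k
  | .prep => 0
  | .trace => 1

/-- Number of output qubits of a gate. -/
@[reducible] def Gate.outputs : Gate → ℕ
  | .unitary k _ _ _ => k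
  | .prep => 1
  | .trace => 0

/-- The channel of a gate: `L ↦ U L U†`, `c ↦ c |0⟩⟨0|`, or `L ↦ Tr L`. The scalars are the
operators on zero qubits. -/
def Gate.channel : (g : Gate) → SuperOp g.inputs g.outputs
  | .unitary _ U _ _ => LinearMap.mulLeft ℂ U ∘ₗ LinearMap.mulRight ℂ U.conjTranspose
  | .prep => (Matrix.traceLinearMap (Bits 0) ℂ ℂ).smulRight (ketbra (n := 1) fun _ => false)
  | .trace => (Matrix.traceLinearMap (Bits 1) ℂ ℂ).smulRight (1 : Operator 0)

/-- A gate set: finitely many gates, listed so that each has a number. -/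
abbrev GateSet : Type := List Gate

/-- A layer of a circuit: gates of `G`, given by their numbers, applied in parallel to consecutive
blocks of qubits. -/
abbrev Layer (G : GateSet) : Type := List (Fin G.length)

/-- Number of input qubits of a layer. -/
@[reducible] def Layer.inputs {G : GateSet} : Layer G → ℕ
  | [] => 0
  | i :: L => (G.get i).inputs + Layer.inputs L

/-- Number of output qubits of a layer. -/
@[reducible] def Layer.outputs {G : GateSet} : Layer G → ℕ
  | [] => 0
  | i :: L => (G.get i).outputs + Layer.outputs L

/-- The tensor product of the channels of the gates in a layer. -/
def Layer.channel {G : GateSet} : (L : Layer G) → SuperOp (Layer.inputs L) (Layer.outputs L)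
  | [] => LinearMap.id
  | i :: L => SuperOp.tensor (G.get i).channel (Layer.channel L)

/-- `(a, b)`-circuits built from `G`: finite sequences of composable layers, the first layer being
applied first. The empty sequence is the identity on `a` qubits. -/
inductive Circuit (G : GateSet) : ℕ → ℕ → Type
  | nil (a : ℕ) : Circuit G a a
  | cons {b : ℕ} (L : Layer G) (C : Circuit G (Layer.outputs L) b) : Circuit G (Layer.inputs L) b

namespace Circuit

/-- The channel that a circuit implements. -/
def channel {G : GateSet} {a b : ℕ} : Circuit G a b → SuperOp a b
  | nil _ => LinearMap.id
  | cons L C => C.channel ∘ₗ Layer.channel L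

/-- `⟨y| C(x) |y⟩`: the probability that the circuit `C`, run on the string `x` and measured in the
computational basis, outputs `y`. -/
def prob {G : GateSet} {a b : ℕ} (C : Circuit G a b) (x : Bits a) (y : Bits b) : ℝ :=
  (C.channel (ketbra x) y y).re

/-- The layers of a circuit, in order. -/
def layers {G : GateSet} {a b : ℕ} : Circuit G a b → List (Layer G)
  | nil _ => []
  | cons L C => L :: C.layers

/-- The description of a layer: the gate of number `i` is written `1^(i+1) 0`, and `0` ends the
layer. -/
def layerCode {G : GateSet} (L : Layer G) : List Bool :=
  L.flatMap (fun i => List.replicate (i.val + 1) true ++ [false]) ++ [false]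

/-- The description of an `(a, b)`-circuit: `1^a 0` followed by the descriptions of its layers. -/
def code {G : GateSet} {a b : ℕ} (C : Circuit G a b) : List Bool :=
  List.replicate a true ++ [false] ++ C.layers.flatMap layerCode

end Circuit

/-- A family of circuits is uniform if some Turing machine, on input `1^n`, halts and outputs the
description of the `n`-th circuit. -/
def IsUniform {G : GateSet} {a b : ℕ → ℕ} (C : ∀ n, Circuit G (a n) (b n)) : Prop :=
  Nonempty (Turing.TM2Computable Computability.unaryEncodeNat id fun n => (C n).code)

/-- A family of circuits is exponential-time if some Turing machine does this within `2^(p(n))`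
steps, for a polynomial `p`. -/
def IsExpTime {G : GateSet} {a b : ℕ → ℕ} (C : ∀ n, Circuit G (a n) (b n)) : Prop :=
  ∃ M : Turing.TM2ComputableInTime Computability.unaryEncodeNat id fun n => (C n).code,
    ∃ p : Polynomial ℕ, ∀ n, M.time n ≤ 2 ^ p.eval n

/-- Computable `q`-ingenerability with respect to a gate set. The only string of length zero is
the input of a `(0, ℓ)`-circuit. -/
def ComputablyIngenerableWrt (G : GateSet) (q : ℕ → ℝ) {ℓ : ℕ → ℕ} (s : ∀ n, Bits (ℓ n)) : Prop :=
  ∀ C : ∀ n, Circuit G 0 (ℓ n), IsUniform C →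
    ∀ᶠ n in Filter.atTop, (C n).prob Fin.elim0 (s n) < q n

/-- Exponential-time `q`-ingenerability with respect to a gate set. -/
def ExpTimeIngenerableWrt (G : GateSet) (q : ℕ → ℝ) {ℓ : ℕ → ℕ} (s : ∀ n, Bits (ℓ n)) : Prop :=
  ∀ C : ∀ n, Circuit G 0 (ℓ n), IsExpTime C →
    ∀ᶠ n in Filter.atTop, (C n).prob Fin.elim0 (s n) < q n

/-- Computably ingenerable `ℓ`-sequences. -/
def ComputablyIngenerable {ℓ : ℕ → ℕ} (s : ∀ n, Bits (ℓ n)) : Prop :=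
  ∀ G : GateSet, ∃ p : Polynomial ℝ,
    ComputablyIngenerableWrt G (fun n => p.eval (n : ℝ) * ((2 : ℝ) ^ ℓ n)⁻¹) s

/-- Exponential-time ingenerable `ℓ`-sequences. -/
def ExpTimeIngenerable {ℓ : ℕ → ℕ} (s : ∀ n, Bits (ℓ n)) : Prop :=
  ∀ G : GateSet, ∃ p : Polynomial ℝ,
    ExpTimeIngenerableWrt G (fun n => p.eval (n : ℝ) * ((2 : ℝ) ^ ℓ n)⁻¹) s

/-- Negligible functions. -/
def Negligible (f : ℕ → ℝ) : Prop :=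
  ∀ c : ℕ, ∀ᶠ n : ℕ in Filter.atTop, f n ≤ ((n : ℝ) ^ c)⁻¹

/-- `⟨1| C(x) |1⟩` for an `(m, 1)`-circuit `C`. -/
def acceptProb {G : GateSet} {m : ℕ} (C : Circuit G m 1) (x : Bits m) : ℝ :=
  C.prob x fun _ => true

/-- The expectation of `⟨1| C(x) |1⟩` over a uniformly random string `x` of length `m`. -/
def avgAcceptProb {G : GateSet} {m : ℕ} (C : Circuit G m 1) : ℝ :=
  𝔼 x : Bits m, acceptProb C x

end QCirc

end

noncomputable section

namespace QCirc

open Turing Function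

/-! The argument is rejection sampling: a circuit that accepts `s n` far more often than an average
string could be used to generate `s n`. Fix `n`, let `m = ℓ n`, let `acc x` be the acceptance
probability of `x` and `a` its mean over `x`. The sampling circuit holds a string, initially `0^m`.
In each of `T = 2^m` rounds it draws a uniform string, runs the given circuit on it, and replaces
the held string by the drawn one exactly when the circuit accepts. Keeping the last accepted string
instead of the first makes a success flag unnecessary.

If `p_t` is the law of the held string after `t` rounds, then `p_{t+1} s = 2^{-m} acc s + (1 - a)
p_t s`, so `p_T s ≥ 2^{-m} (acc s) S` with `S = ∑_{j<T} (1 - a)^j` (`le_roundProb`). Since `S a = 1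
- (1 - a)^T` and `S / T ≥ (1 - a)^T`, one has `1 ≤ S (1/T + a)` (`one_le_geom_sum_mul`). With `T =
2^m` this reads `acc s ≤ 2^m p_T(s) (2^{-m} + a)`, and ingenerability for the gate set enlarged by
six auxiliary gates bounds `2^m p_T(s)` by a polynomial (`acceptProb_le_of_prob_lt`).

The given circuit consumes its input, so the drawn string is produced by `m` Bell pairs: one half of
each pair is fed to the circuit, the other half is kept. Controlled swaps steered by the output bit
select the new string; tracing out the control bit and the other string removes all interference. As
gates act on consecutive qubits, further layers first bring the halves into position. Channels are
compared through their matrix elements, indexed by lists of pairs (row bit, column bit), for which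
tensor products become concatenations. The key computation is `layersKer_roundLayers`;
`layersKer_rep_roundLayers` turns it into the recursion for `p_t`.

The new family must also be uniform. A small language of stack programs is compiled to `TM2`
machines (`Exec.stepsTo`) and run on the output of the given machine (`postTM_stepsTo`). The program
writes the description of one round and doubles it `m` times (`runs_sampleProg`). Its running time
is `2^m` times a polynomial in `m` and the length of the given description. That length is at most
exponential if the given machine is exponential-time (`exists_length_le_time`), and `2^(ℓ n)` is at
most exponential because `ℓ` is polynomially bounded. -/

/-! ### Runs of a partial step function -/

/-- `f` leads from `a` to `b` in exactly `t` steps. -/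
def StepsTo {σ : Type*} (f : σ → Option σ) (t : ℕ) (a b : σ) : Prop :=
  (flip bind f)^[t] (some a) = some b

theorem iterate_bind_none {σ : Type*} (f : σ → Option σ) (t : ℕ) :
    (flip bind f)^[t] (none : Option σ) = none := by
  induction t with
  | zero => rfl
  | succ t ih => rw [iterate_succ_apply]; exact ih

theorem StepsTo.refl {σ : Type*} (f : σ → Option σ) (a : σ) : StepsTo f 0 a a := rfl

theorem StepsTo.head {σ : Type*} {f : σ → Option σ} {t : ℕ} {a b c : σ} (h : f a = some b)
    (h' : StepsTo f t b c) : StepsTo f (t + 1) a c := by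
  unfold StepsTo at *
  rw [iterate_succ_apply, ← h', ← h]; rfl

theorem StepsTo.single {σ : Type*} {f : σ → Option σ} {a b : σ} (h : f a = some b) :
    StepsTo f 1 a b := (StepsTo.refl f b).head h

theorem StepsTo.trans {σ : Type*} {f : σ → Option σ} {s t : ℕ} {a b c : σ}
    (h : StepsTo f s a b) (h' : StepsTo f t b c) : StepsTo f (s + t) a c := by
  unfold StepsTo at *
  rw [add_comm, iterate_add_apply, h, h']

theorem StepsTo.exists_head {σ : Type*} {f : σ → Option σ} {t : ℕ} {a c : σ}
    (h : StepsTo f (t + 1) a c) : ∃ b, f a = some b ∧ StepsTo f t b c := by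
  unfold StepsTo at *
  rw [iterate_succ_apply] at h
  cases hfa : f a with
  | none =>
    have : flip bind f (some a) = none := hfa
    rw [this, iterate_bind_none] at h
    cases h
  | some b =>
    have : flip bind f (some a) = some b := hfa
    rw [this] at h
    exact ⟨b, rfl, h⟩

/-! ### A structured language of stack programs -/

/-- Programs on stacks of bits. `emit k w` pushes the letters of `w` in order; `loop k p q` pops
`k` until it is empty and runs `p` or `q` according to the popped bit; `whileTrue k p` pops `k` and
runs `p` as long as the popped bit is `true`. -/
inductive Prog (K : Type) : Type
  | emit (k : K) (w : List Bool) : Prog K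
  | seq (p q : Prog K) : Prog K
  | loop (k : K) (p q : Prog K) : Prog K
  | whileTrue (k : K) (p : Prog K) : Prog K

namespace Prog

variable {K : Type}

/-- Big-step semantics of programs with the number of steps. -/
inductive Exec [DecidableEq K] :
    Prog K → (K → List Bool) → (K → List Bool) → ℕ → Prop
  | emit (k w T) : Exec (emit k w) T (update T k (w.reverse ++ T k)) 1
  | seq {p q T₀ T₁ T₂ t₁ t₂} : Exec p T₀ T₁ t₁ → Exec q T₁ T₂ t₂ → Exec (seq p q) T₀ T₂ (t₁ + t₂)
  | loop_nil {k p q T} : T k = [] → Exec (loop k p q) T T 1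
  | loop_true {k p q T T₁ T₂ l t₁ t₂} : T k = true :: l → Exec p (update T k l) T₁ t₁ →
      Exec (loop k p q) T₁ T₂ t₂ → Exec (loop k p q) T T₂ (1 + t₁ + t₂)
  | loop_false {k p q T T₁ T₂ l t₁ t₂} : T k = false :: l → Exec q (update T k l) T₁ t₁ →
      Exec (loop k p q) T₁ T₂ t₂ → Exec (loop k p q) T T₂ (1 + t₁ + t₂)
  | while_nil {k p T} : T k = [] → Exec (whileTrue k p) T T 1
  | while_true {k p T T₁ T₂ l t₁ t₂} : T k = true :: l → Exec p (update T k l) T₁ t₁ →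
      Exec (whileTrue k p) T₁ T₂ t₂ → Exec (whileTrue k p) T T₂ (1 + t₁ + t₂)
  | while_false {k p T l} : T k = false :: l → Exec (whileTrue k p) T (update T k l) 1

/-- The largest number of letters that a program pushes in one step. -/
def width : Prog K → ℕ
  | emit _ w => w.length
  | seq p q => max p.width q.width
  | loop _ p q => max p.width q.width
  | whileTrue _ p => p.width

theorem length_le_of_length_eq_cons [DecidableEq K] {T : K → List Bool} {k j : K} {b : Bool}
    {l : List Bool} (h : T k = b :: l) : (update T k l j).length ≤ (T j).length := by
  by_cases hj : j = k
  · subst hj; simp [h]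
  · simp [update_of_ne hj]

/-- Each step pushes at most `width` letters. This later bounds the length of the description of a
round by the time taken to write it, without computing that length. -/
theorem Exec.length_le [DecidableEq K] {p : Prog K} {T T' : K → List Bool} {t : ℕ}
    (h : Exec p T T' t) (j : K) {w : ℕ} (hw : p.width ≤ w) :
    (T' j).length ≤ (T j).length + w * t := by
  induction h with
  | emit k v T =>
    by_cases hj : j = k
    · subst hj
      have : v.length ≤ w := hw
      simp; omega
    · simp [update_of_ne hj]
  | seq _ _ ih₁ ih₂ =>
    have := ih₁ ((le_max_left _ _).trans hw)
    have := ih₂ ((le_max_right _ _).trans hw)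
    rw [mul_add]; omega
  | loop_nil _ => omega
  | loop_true hT _ _ ih₁ ih₂ =>
    have := length_le_of_length_eq_cons (j := j) hT
    have := ih₁ ((le_max_left _ _).trans hw)
    have := ih₂ hw
    rw [mul_add, mul_add]; omega
  | loop_false hT _ _ ih₁ ih₂ =>
    have := length_le_of_length_eq_cons (j := j) hT
    have := ih₁ ((le_max_right _ _).trans hw)
    have := ih₂ hw
    rw [mul_add, mul_add]; omega
  | while_nil _ => omega
  | while_true hT _ _ ih₁ ih₂ =>
    have := length_le_of_length_eq_cons (j := j) hT
    have := ih₁ hw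
    have := ih₂ hw
    rw [mul_add, mul_add]; omega
  | while_false hT =>
    have := length_le_of_length_eq_cons (j := j) hT
    omega

/-- The labels of the compiled program. -/
@[reducible] def Lab : Prog K → Type
  | emit _ _ => Unit
  | seq p q => p.Lab ⊕ q.Lab
  | loop _ p q => Option (p.Lab ⊕ q.Lab)
  | whileTrue _ p => Option p.Lab

instance fintypeLab : (p : Prog K) → Fintype p.Lab
  | emit _ _ => inferInstanceAs (Fintype Unit)
  | seq p q => @instFintypeSum _ _ (fintypeLab p) (fintypeLab q)
  | loop _ p q => @instFintypeOption _ (@instFintypeSum _ _ (fintypeLab p) (fintypeLab q))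
  | whileTrue _ p => @instFintypeOption _ (fintypeLab p)

/-- The label at which the compiled program starts. -/
def entry : (p : Prog K) → p.Lab
  | emit _ _ => ()
  | seq p _ => Sum.inl p.entry
  | loop _ _ _ => none
  | whileTrue _ _ => none

/-! ### Compilation of stack programs into `TM2` statements -/

section compile

variable {J Λ σ : Type} {Γ : J → Type}

/-- The alphabets `Γ` together with the alphabet of bits for the stacks in `K`. -/
@[reducible] def JoinΓ (Γ : J → Type) (K : Type) : J ⊕ K → Type
  | .inl j => Γ j
  | .inr _ => Bool

/-- Push the letters of a word in order and go to `next`. -/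
def emitStmt (k : K) (next : Λ) :
    List Bool → TM2.Stmt (JoinΓ Γ K) Λ (σ × Option Bool)
  | [] => .goto fun _ => next
  | b :: w => .push (Sum.inr k) (fun _ => b) (emitStmt k next w)

/-- Pop a bit of stack `k` and go to one of three labels. -/
def popStmt (k : K) (l₀ l₁ next : Λ) :
    TM2.Stmt (JoinΓ Γ K) Λ (σ × Option Bool) :=
  .pop (Sum.inr k) (fun v o => (v.1, o)) (.goto fun v => v.2.elim next fun b => cond b l₁ l₀)

/-- The compiled program, with its labels embedded by `ι` and leaving to `next`. -/
def compile : (p : Prog K) → (p.Lab → Λ) → Λ → p.Lab →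
    TM2.Stmt (JoinΓ Γ K) Λ (σ × Option Bool)
  | emit k w, _, next, _ => emitStmt k next w
  | seq p q, ι, _, .inl l => p.compile (fun l => ι (Sum.inl l)) (ι (Sum.inr q.entry)) l
  | seq _ q, ι, next, .inr l => q.compile (fun l => ι (Sum.inr l)) next l
  | loop k p q, ι, next, none =>
      popStmt k (ι (some (Sum.inr q.entry))) (ι (some (Sum.inl p.entry))) next
  | loop _ p _, ι, _, some (.inl l) => p.compile (fun l => ι (some (Sum.inl l))) (ι none) l
  | loop _ _ q, ι, _, some (.inr l) => q.compile (fun l => ι (some (Sum.inr l))) (ι none) l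
  | whileTrue k p, ι, next, none => popStmt k next (ι (some p.entry)) next
  | whileTrue _ p, ι, _, some l => p.compile (fun l => ι (some l)) (ι none) l

/-- Two families of stacks side by side. -/
def joinStk (S : ∀ j, List (Γ j)) (T : K → List Bool) :
    ∀ k, List (JoinΓ Γ K k)
  | .inl j => S j
  | .inr k => T k

theorem joinStk_inl (S : ∀ j, List (Γ j)) (T : K → List Bool) (j : J) :
    joinStk S T (Sum.inl j) = S j := rfl

theorem joinStk_inr (S : ∀ j, List (Γ j)) (T : K → List Bool) (k : K) :
    joinStk S T (Sum.inr k) = T k := rfl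

variable [DecidableEq J] [DecidableEq K]

theorem update_joinStk_inr (S : ∀ j, List (Γ j)) (T : K → List Bool) (k : K) (l : List Bool) :
    update (joinStk S T) (Sum.inr k) l = joinStk S (update T k l) := by
  funext j
  rcases j with j | j
  · rw [update_of_ne (by simp)]; rfl
  · by_cases h : j = k
    · subst h; rw [update_self, joinStk_inr, update_self]
    · rw [update_of_ne (by simpa using h), joinStk_inr, joinStk_inr, update_of_ne h]

theorem update_joinStk_inl (S : ∀ j, List (Γ j)) (T : K → List Bool) (k : J) (l : List (Γ k)) :
    update (joinStk S T) (Sum.inl k) l = joinStk (update S k l) T := by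
  funext j
  rcases j with j | j
  · by_cases h : j = k
    · subst h; rw [update_self, joinStk_inl, update_self]
    · rw [update_of_ne (by simpa using h), joinStk_inl, joinStk_inl, update_of_ne h]
  · rw [update_of_ne (by simp)]; rfl

theorem stepAux_emitStmt (k : K) (next : Λ) (w : List Bool) (v : σ × Option Bool)
    (S : ∀ j, List (Γ j)) (T : K → List Bool) :
    TM2.stepAux (emitStmt k next w) v (joinStk S T) =
      ⟨some next, v, joinStk S (update T k (w.reverse ++ T k))⟩ := by
  induction w generalizing T with
  | nil => simp [emitStmt]
  | cons b w ih =>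
    simp only [emitStmt, TM2.stepAux.eq_1]
    refine (congrArg _ (update_joinStk_inr S T k (b :: T k))).trans ?_
    rw [ih]
    simp

theorem stepAux_popStmt (k : K) (l₀ l₁ next : Λ) (v : σ × Option Bool)
    (S : ∀ j, List (Γ j)) (T : K → List Bool) :
    TM2.stepAux (popStmt k l₀ l₁ next) v (joinStk S T) =
      ⟨some ((T k).head?.elim next fun b => cond b l₁ l₀), (v.1, (T k).head?),
        joinStk S (update T k (T k).tail)⟩ := by
  simp only [popStmt, TM2.stepAux.eq_3, TM2.stepAux.eq_6]
  congr 1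
  exact update_joinStk_inr S T k (T k).tail

theorem update_eq_self_of_eq_nil {T : K → List Bool} {k : K} (h : T k = []) :
    update T k [] = T := by
  rw [← h, update_eq_self]

/-- Induction on the derivation; the costs in `Exec` are chosen so that each unit is one machine
step. The label embedding and the exit label vary because a subprogram is compiled inside a larger
one and leaves to its continuation. The last component of the state only buffers the popped bit,
hence the existential. -/
theorem Exec.stepsTo {p : Prog K} {T T' : K → List Bool} {t : ℕ} (h : Exec p T T' t)
    (m : Λ → TM2.Stmt (JoinΓ Γ K) Λ (σ × Option Bool)) (S : ∀ j, List (Γ j))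
    (ι : p.Lab → Λ) (next : Λ) (hm : ∀ l, m (ι l) = p.compile ι next l) (v : σ) (o : Option Bool) :
    ∃ o', StepsTo (TM2.step m) t ⟨some (ι p.entry), (v, o), joinStk S T⟩
      ⟨some next, (v, o'), joinStk S T'⟩ := by
  induction h generalizing o next with
  | emit k w T =>
    refine ⟨o, StepsTo.single ?_⟩
    rw [TM2.step.eq_2, hm]
    exact congrArg some (stepAux_emitStmt k next w (v, o) S T)
  | @seq p q T₀ T₁ T₂ t₁ t₂ _ _ ih₁ ih₂ =>
    obtain ⟨o₁, h₁⟩ := ih₁ (fun l => ι (Sum.inl l)) (ι (Sum.inr q.entry))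
      (fun l => hm (Sum.inl l)) o
    obtain ⟨o₂, h₂⟩ := ih₂ (fun l => ι (Sum.inr l)) next (fun l => hm (Sum.inr l)) o₁
    exact ⟨o₂, h₁.trans h₂⟩
  | @loop_nil k p q T hT =>
    refine ⟨none, StepsTo.single ?_⟩
    rw [TM2.step.eq_2, hm, entry, compile, stepAux_popStmt]
    simp [hT, update_eq_self_of_eq_nil hT]
  | @loop_true k p q T T₁ T₂ l t₁ t₂ hT _ _ ih₁ ih₂ =>
    obtain ⟨o₁, h₁⟩ := ih₁ (fun l => ι (some (Sum.inl l))) (ι none)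
      (fun l => hm (some (Sum.inl l))) (some true)
    obtain ⟨o₂, h₂⟩ := ih₂ ι next hm o₁
    refine ⟨o₂, (StepsTo.trans (StepsTo.single ?_) h₁).trans h₂⟩
    rw [TM2.step.eq_2, hm, entry, compile, stepAux_popStmt]
    simp [hT]
  | @loop_false k p q T T₁ T₂ l t₁ t₂ hT _ _ ih₁ ih₂ =>
    obtain ⟨o₁, h₁⟩ := ih₁ (fun l => ι (some (Sum.inr l))) (ι none)
      (fun l => hm (some (Sum.inr l))) (some false)
    obtain ⟨o₂, h₂⟩ := ih₂ ι next hm o₁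
    refine ⟨o₂, (StepsTo.trans (StepsTo.single ?_) h₁).trans h₂⟩
    rw [TM2.step.eq_2, hm, entry, compile, stepAux_popStmt]
    simp [hT]
  | @while_nil k p T hT =>
    refine ⟨none, StepsTo.single ?_⟩
    rw [TM2.step.eq_2, hm, entry, compile, stepAux_popStmt]
    simp [hT, update_eq_self_of_eq_nil hT]
  | @while_true k p T T₁ T₂ l t₁ t₂ hT _ _ ih₁ ih₂ =>
    obtain ⟨o₁, h₁⟩ := ih₁ (fun l => ι (some l)) (ι none) (fun l => hm (some l)) (some true)
    obtain ⟨o₂, h₂⟩ := ih₂ ι next hm o₁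
    refine ⟨o₂, (StepsTo.trans (StepsTo.single ?_) h₁).trans h₂⟩
    rw [TM2.step.eq_2, hm, entry, compile, stepAux_popStmt]
    simp [hT]
  | @while_false k p T l hT =>
    refine ⟨some false, StepsTo.single ?_⟩
    rw [TM2.step.eq_2, hm, entry, compile, stepAux_popStmt]
    simp [hT]

end compile

end Prog

/-! ### Running a program on the output of a Turing machine -/

section postcomposition

open Prog (JoinΓ)

variable {K : Type} [DecidableEq K]

/-- Labels of the machine that runs a program on the output of another machine. -/
abbrev PostLab (tm : FinTM2) (p : Prog K) : Type := tm.Λ ⊕ (Bool ⊕ p.Lab)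

/-- Statements of `tm` as statements of the larger machine; halting becomes a jump. -/
def liftStmt (tm : FinTM2) (p : Prog K) : TM2.Stmt tm.Γ tm.Λ tm.σ →
    TM2.Stmt (JoinΓ tm.Γ K) (PostLab tm p) (tm.σ × Option Bool)
  | .push k f q => .push (Sum.inl k) (fun v => f v.1) (liftStmt tm p q)
  | .peek k f q => .peek (Sum.inl k) (fun v o => (f v.1 o, v.2)) (liftStmt tm p q)
  | .pop k f q => .pop (Sum.inl k) (fun v o => (f v.1 o, v.2)) (liftStmt tm p q)
  | .load f q => .load (fun v => (f v.1, v.2)) (liftStmt tm p q)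
  | .branch f q₁ q₂ => .branch (fun v => f v.1) (liftStmt tm p q₁) (liftStmt tm p q₂)
  | .goto f => .goto fun v => Sum.inl (f v.1)
  | .halt => .goto fun _ => Sum.inr (Sum.inl false)

/-- Transfer the output of `tm` to the stack `k`. -/
def transferStmt (tm : FinTM2) (p : Prog K) (e : tm.Γ tm.k₁ → Bool) (k : K) :
    TM2.Stmt (JoinΓ tm.Γ K) (PostLab tm p) (tm.σ × Option Bool) :=
  .pop (Sum.inl tm.k₁) (fun v o => (v.1, o.map e))
    (.branch (fun v => v.2.isSome)
      (.push (Sum.inr k) (fun v => v.2.getD false) (.goto fun _ => Sum.inr (Sum.inl false)))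
      (.goto fun _ => Sum.inr (Sum.inr p.entry)))

/-- The machine that runs `tm`, transfers its output to the stack `k`, which reverses it, and then
runs the program `p`; the output of `p` is on the stack `k'`. -/
def postTM [Fintype K] (tm : FinTM2) (p : Prog K) (e : tm.Γ tm.k₁ → Bool) (k k' : K) : FinTM2 where
  K := tm.K ⊕ K
  kDecidableEq := @instDecidableEqSum _ _ tm.kDecidableEq _
  kFin := @instFintypeSum _ _ tm.kFin _
  k₀ := Sum.inl tm.k₀
  k₁ := Sum.inr k'
  Γ := JoinΓ tm.Γ K
  Λ := PostLab tm p
  main := Sum.inl tm.main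
  ΛFin := @instFintypeSum _ _ tm.ΛFin inferInstance
  σ := tm.σ × Option Bool
  initialState := (tm.initialState, none)
  σFin := @instFintypeProd _ _ tm.σFin inferInstance
  Γk₀Fin := tm.Γk₀Fin
  m
    | .inl l => liftStmt tm p (tm.m l)
    | .inr (.inl false) => transferStmt tm p e k
    -- A halting configuration must carry the initial internal state, so the bit buffer is cleared
    -- before halting.
    | .inr (.inl true) => .load (fun _ => (tm.initialState, none)) .halt
    | .inr (.inr l) => p.compile (fun l => Sum.inr (Sum.inr l)) (Sum.inr (Sum.inl true)) l

/-- Configurations of `tm` as configurations of the larger machine. -/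
def liftCfg (tm : FinTM2) (p : Prog K) (c : TM2.Cfg tm.Γ tm.Λ tm.σ) :
    TM2.Cfg (JoinΓ tm.Γ K) (PostLab tm p) (tm.σ × Option Bool) :=
  ⟨some (c.l.elim (Sum.inr (Sum.inl false)) Sum.inl), (c.var, none),
    Prog.joinStk c.stk fun _ => []⟩

/-- Lifted statements touch neither the bit buffer nor the stacks of the program, so these stay
`none` and empty. -/
theorem stepAux_liftStmt (tm : FinTM2) (p : Prog K) (q : TM2.Stmt tm.Γ tm.Λ tm.σ) (v : tm.σ)
    (S : ∀ j, List (tm.Γ j)) :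
    TM2.stepAux (liftStmt tm p q) (v, none) (Prog.joinStk S fun _ => []) =
      liftCfg tm p (TM2.stepAux q v S) := by
  induction q generalizing v S with
  | push k f q ih =>
    refine Eq.trans ?_ (ih v (update S k (f v :: S k)))
    exact congrArg _ (Prog.update_joinStk_inl S _ k _)
  | peek k f q ih => exact ih _ _
  | pop k f q ih =>
    refine Eq.trans ?_ (ih (f v (S k).head?) (update S k (S k).tail))
    exact congrArg _ (Prog.update_joinStk_inl S _ k _)
  | load f q ih => exact ih _ _
  | branch f q₁ q₂ ih₁ ih₂ =>
    simp only [liftStmt, TM2.stepAux.eq_5]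
    cases f v
    · exact ih₂ _ _
    · exact ih₁ _ _
  | goto f => rfl
  | halt => rfl

theorem stepsTo_liftCfg [Fintype K] (tm : FinTM2) (p : Prog K) (e : tm.Γ tm.k₁ → Bool) (k k' : K) {t : ℕ}
    {c c' : TM2.Cfg tm.Γ tm.Λ tm.σ} (h : StepsTo (TM2.step tm.m) t c c') :
    StepsTo (TM2.step (postTM tm p e k k').m) t (liftCfg tm p c) (liftCfg tm p c') := by
  induction t generalizing c with
  | zero =>
    have : c = c' := by simpa [StepsTo] using h
    subst this
    exact StepsTo.refl _ _
  | succ t ih =>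
    obtain ⟨b, hb, hbc⟩ := h.exists_head
    refine StepsTo.head ?_ (ih hbc)
    rcases c with ⟨_ | l, v, S⟩
    · simp at hb
    · rw [TM2.step.eq_2, Option.some.injEq] at hb
      subst hb
      exact congrArg some (stepAux_liftStmt tm p (tm.m l) v S)

theorem stepAux_transferStmt_nil (tm : FinTM2) (p : Prog K) (e : tm.Γ tm.k₁ → Bool) (k : K)
    (v : tm.σ × Option Bool) (S : ∀ j, List (tm.Γ j)) (T : K → List Bool) (h : S tm.k₁ = []) :
    TM2.stepAux (transferStmt tm p e k) v (Prog.joinStk S T) =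
      ⟨some (Sum.inr (Sum.inr p.entry)), (v.1, none), Prog.joinStk S T⟩ := by
  have hS : update S tm.k₁ [] = S := by rw [← h, update_eq_self]
  simp only [transferStmt, TM2.stepAux.eq_3, TM2.stepAux.eq_5, TM2.stepAux.eq_6, Prog.joinStk_inl,
    h, List.head?_nil, Option.map_none, Option.isSome_none, cond_false, List.tail_nil,
    Prog.update_joinStk_inl, hS]

theorem stepAux_transferStmt_cons (tm : FinTM2) (p : Prog K) (e : tm.Γ tm.k₁ → Bool) (k : K)
    (v : tm.σ × Option Bool) (S : ∀ j, List (tm.Γ j)) (T : K → List Bool) {a : tm.Γ tm.k₁}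
    {l : List (tm.Γ tm.k₁)} (h : S tm.k₁ = a :: l) :
    TM2.stepAux (transferStmt tm p e k) v (Prog.joinStk S T) =
      ⟨some (Sum.inr (Sum.inl false)), (v.1, some (e a)),
        Prog.joinStk (update S tm.k₁ l) (update T k (e a :: T k))⟩ := by
  simp only [transferStmt, TM2.stepAux.eq_3, TM2.stepAux.eq_5, TM2.stepAux.eq_6,
    TM2.stepAux.eq_1, Prog.joinStk_inl, h, List.head?_cons, Option.map_some, Option.isSome_some,
    cond_true, List.tail_cons, Prog.update_joinStk_inl, Prog.joinStk_inr, Option.getD_some,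
    Prog.update_joinStk_inr]

/-- One step per letter, and one more to find the stack empty. Popping and pushing reverses the
word. -/
theorem transfer_stepsTo [Fintype K] (tm : FinTM2) (p : Prog K) (e : tm.Γ tm.k₁ → Bool) (k k' : K) (v : tm.σ)
    (o : Option Bool) (l : List (tm.Γ tm.k₁)) (S : ∀ j, List (tm.Γ j)) (T : K → List Bool) :
    StepsTo (TM2.step (postTM tm p e k k').m) (l.length + 1)
      ⟨some (Sum.inr (Sum.inl false)), (v, o), Prog.joinStk (update S tm.k₁ l) T⟩
      ⟨some (Sum.inr (Sum.inr p.entry)), (v, none),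
        Prog.joinStk (update S tm.k₁ []) (update T k ((l.map e).reverse ++ T k))⟩ := by
  induction l generalizing o T with
  | nil =>
    refine StepsTo.single (congrArg some ?_)
    rw [List.map_nil, List.reverse_nil, List.nil_append, update_eq_self]
    exact stepAux_transferStmt_nil tm p e k (v, o) _ T (by simp)
  | cons a l ih =>
    have h := ih (some (e a)) (update T k (e a :: T k))
    simp only [update_self, update_idem] at h
    simp only [List.map_cons, List.reverse_cons, List.append_assoc, List.singleton_append]
    refine h.head (congrArg some ?_)
    refine (stepAux_transferStmt_cons tm p e k (v, o) _ T (update_self _ _ _)).trans ?_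
    rw [update_idem]
    rfl

theorem initList_eq (tm : FinTM2) (w : List (tm.Γ tm.k₀)) :
    initList tm w = ⟨some tm.main, tm.initialState, update (fun _ => []) tm.k₀ w⟩ := by
  refine congrArg (TM2.Cfg.mk _ _) (funext fun j => ?_)
  by_cases hj : j = tm.k₀
  · subst hj; rw [update_self, dif_pos rfl]; rfl
  · rw [update_of_ne hj, dif_neg hj]

theorem haltList_eq (tm : FinTM2) (w : List (tm.Γ tm.k₁)) :
    haltList tm w = ⟨none, tm.initialState, update (fun _ => []) tm.k₁ w⟩ := by
  refine congrArg (TM2.Cfg.mk _ _) (funext fun j => ?_)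
  by_cases hj : j = tm.k₁
  · subst hj; rw [update_self, dif_pos rfl]; rfl
  · rw [update_of_ne hj, dif_neg hj]

theorem joinStk_nil {J K : Type} {Γ : J → Type} :
    Prog.joinStk (fun _ => []) (fun _ => []) = fun k => ([] : List (JoinΓ Γ K k)) := by
  funext k; rcases k with k | k <;> rfl

/-- Four phases are concatenated: the run of `tm`, the transfer, the program, and the final halting
step. Since `tm` halts with only its output stack filled, its stacks are all empty after the
transfer, as a halting configuration of the large machine demands. -/
theorem postTM_stepsTo [Fintype K] (tm : FinTM2) (p : Prog K) (e : tm.Γ tm.k₁ → Bool) (k k' : K)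
    (w : List (tm.Γ tm.k₀)) (r : List (tm.Γ tm.k₁)) (r' : List Bool) {t t' : ℕ}
    (h : StepsTo tm.step t (initList tm w) (haltList tm r))
    (hp : p.Exec (update (fun _ => []) k (r.map e).reverse) (update (fun _ => []) k' r') t') :
    StepsTo (postTM tm p e k k').step (t + (r.length + 1) + t' + 1)
      (initList (postTM tm p e k k') w) (haltList (postTM tm p e k k') r') := by
  obtain ⟨o, ho⟩ := hp.stepsTo (postTM tm p e k k').m (fun _ => [])
    (fun l => Sum.inr (Sum.inr l)) (Sum.inr (Sum.inl true)) (fun _ => rfl) tm.initialState none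
  have h₁ := stepsTo_liftCfg tm p e k k' h
  have h₂ := transfer_stepsTo tm p e k k' tm.initialState none r (fun _ => []) (fun _ => [])
  have hi : initList (postTM tm p e k k') w = liftCfg tm p (initList tm w) := by
    refine (initList_eq (postTM tm p e k k') w).trans
      (Eq.trans ?_ (congrArg (liftCfg tm p) (initList_eq tm w)).symm)
    refine congrArg (TM2.Cfg.mk _ _) ?_
    refine Eq.trans ?_ (Prog.update_joinStk_inl (fun _ => []) (fun _ => []) tm.k₀ w)
    rw [joinStk_nil]
    rfl
  have hf : haltList (postTM tm p e k k') r' = (⟨none, (tm.initialState, none),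
      Prog.joinStk (fun _ => []) (update (fun _ => []) k' r')⟩ :
        TM2.Cfg (JoinΓ tm.Γ K) (PostLab tm p) (tm.σ × Option Bool)) := by
    refine (haltList_eq (postTM tm p e k k') r').trans ?_
    refine congrArg (TM2.Cfg.mk _ _) ?_
    refine Eq.trans ?_ (Prog.update_joinStk_inr (fun _ => []) (fun _ => []) k' r')
    rw [joinStk_nil]
    rfl
  rw [haltList_eq tm r] at h₁
  have h₃ := h₁.trans h₂
  rw [List.append_nil, show update (fun _ => []) tm.k₁ [] = fun j => ([] : List (tm.Γ j)) from
    update_eq_self _ _] at h₃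
  refine hi ▸ hf ▸ (h₃.trans ho).trans (StepsTo.single (congrArg some rfl))

end postcomposition

/-! ### The length of the output of a Turing machine -/

/-- The number of pushes in a statement. -/
def stmtPushes {K Λ σ : Type} {Γ : K → Type} : TM2.Stmt Γ Λ σ → ℕ
  | .push _ _ q => stmtPushes q + 1
  | .peek _ _ q => stmtPushes q
  | .pop _ _ q => stmtPushes q
  | .load _ q => stmtPushes q
  | .branch _ q₁ q₂ => max (stmtPushes q₁) (stmtPushes q₂)
  | .goto _ => 0
  | .halt => 0

theorem length_stepAux_le {K Λ σ : Type} [DecidableEq K] {Γ : K → Type} (q : TM2.Stmt Γ Λ σ) (v : σ)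
    (S : ∀ k, List (Γ k)) (k : K) :
    ((TM2.stepAux q v S).stk k).length ≤ (S k).length + stmtPushes q := by
  induction q generalizing v S with
  | push j f q ih =>
    refine (ih v _).trans ?_
    by_cases h : k = j
    · subst h; simp [stmtPushes]; omega
    · simp [update_of_ne h, stmtPushes]
  | peek j f q ih => exact ih _ _
  | pop j f q ih =>
    refine (ih _ _).trans ?_
    by_cases h : k = j
    · subst h; simp [stmtPushes]
    · simp [update_of_ne h, stmtPushes]
  | load f q ih => exact ih _ _
  | branch f q₁ q₂ ih₁ ih₂ =>
    simp only [TM2.stepAux.eq_5, stmtPushes]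
    cases f v
    · exact (ih₂ v S).trans (by simp)
    · exact (ih₁ v S).trans (by simp)
  | goto f => simp [stmtPushes]
  | halt => simp [stmtPushes]

/-- A machine has finitely many labels, so the number of pushes per step is bounded. The term
`w.length` is there because the output stack may be the input stack. -/
theorem exists_output_length_le (tm : FinTM2) : ∃ c : ℕ, ∀ (w : List (tm.Γ tm.k₀))
    (r : List (tm.Γ tm.k₁)) (t : ℕ), StepsTo tm.step t (initList tm w) (haltList tm r) →
      r.length ≤ w.length + c * t := by
  have := tm.ΛFin
  refine ⟨Finset.univ.sup fun l => stmtPushes (tm.m l), fun w r t h => ?_⟩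
  set c := Finset.univ.sup fun l => stmtPushes (tm.m l) with hc
  have key : ∀ (t : ℕ) (a b : TM2.Cfg tm.Γ tm.Λ tm.σ), StepsTo (TM2.step tm.m) t a b → ∀ k,
      (b.stk k).length ≤ (a.stk k).length + c * t := by
    intro t
    induction t with
    | zero =>
      intro a b h k
      have : a = b := by simpa [StepsTo] using h
      subst this; simp
    | succ t ih =>
      intro a b h k
      obtain ⟨a', ha', h'⟩ := h.exists_head
      have h₂ := ih a' b h' k
      rcases a with ⟨_ | l, v, S⟩
      · simp at ha'
      · rw [TM2.step.eq_2, Option.some.injEq] at ha'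
        subst ha'
        have h₁ := length_stepAux_le (tm.m l) v S k
        have h₃ : stmtPushes (tm.m l) ≤ c :=
          Finset.le_sup (f := fun l => stmtPushes (tm.m l)) (Finset.mem_univ l)
        rw [mul_add, mul_one]
        change _ ≤ (S k).length + _
        omega
  have h₁ := key t _ _ h tm.k₁
  rw [initList_eq, haltList_eq] at h₁
  dsimp only at h₁
  rw [update_self] at h₁
  refine h₁.trans (Nat.add_le_add_right ?_ _)
  by_cases hk : tm.k₁ = tm.k₀
  -- The alphabet depends on the stack, so the equality is eliminated for a variable stack.
  · have : ∀ (k : tm.K) (hk : k = tm.k₀),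
        (update (fun j => ([] : List (tm.Γ j))) tm.k₀ w k).length ≤ w.length := by
      rintro k rfl; simp
    exact this _ hk
  · simp [update_of_ne hk]

/-! ### Computability of the composed function -/

section computable

variable {K : Type} [DecidableEq K] [Fintype K] {α : Type} {ea : α → List Bool}
  {f g : α → List Bool}

/-- Postcomposition of a computable function with a program. The program receives its input reversed
because the transfer reverses it. -/
theorem tm2Computable_of_exec (M : TM2Computable ea id f) (p : Prog K) (k k' : K)
    (h : ∀ a, ∃ t, p.Exec (update (fun _ => []) k (f a).reverse) (update (fun _ => []) k' (g a)) t) :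
    Nonempty (TM2Computable ea id g) := by
  choose t ht using h
  refine ⟨⟨⟨postTM M.tm p M.outputAlphabet k k', M.inputAlphabet, Equiv.refl Bool⟩, fun a =>
    ⟨(M.outputsFun a).steps + ((List.map M.outputAlphabet.invFun (f a)).length + 1) + t a + 1, ?_⟩⟩⟩
  have := postTM_stepsTo M.tm p M.outputAlphabet k k' _ _ (g a) (M.outputsFun a).evals_in_steps
    (t' := t a) (by
      convert ht a using 3
      simp)
  refine Eq.trans this ?_
  simp only [Option.map_some, id]
  congr 2
  exact (List.map_id _).symm

theorem tm2ComputableInTime_of_exec (M : TM2ComputableInTime ea id f) (p : Prog K) (k k' : K)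
    (B : α → ℕ) (h : ∀ a, ∃ t ≤ B a,
      p.Exec (update (fun _ => []) k (f a).reverse) (update (fun _ => []) k' (g a)) t)
    (time : ℕ → ℕ) (htime : ∀ a, M.time (ea a).length + ((f a).length + 1) + B a + 1 ≤
      time (ea a).length) :
    ∃ M' : TM2ComputableInTime ea id g, M'.time = time := by
  choose t htB ht using h
  refine ⟨⟨⟨postTM M.tm p M.outputAlphabet k k', M.inputAlphabet, Equiv.refl Bool⟩, time, fun a =>
    ⟨⟨(M.outputsFun a).steps + ((List.map M.outputAlphabet.invFun (f a)).length + 1) + t a + 1, ?_⟩,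
      ?_⟩⟩, rfl⟩
  · have := postTM_stepsTo M.tm p M.outputAlphabet k k' _ _ (g a) (M.outputsFun a).evals_in_steps
      (t' := t a) (by
        convert ht a using 3
        simp)
    refine Eq.trans this ?_
    simp only [Option.map_some, id]
    congr 2
    exact (List.map_id _).symm
  · have := (M.outputsFun a).steps_le_m
    have := htB a
    have := htime a
    have := List.length_map (as := f a) M.outputAlphabet.invFun
    change (M.outputsFun a).steps + ((List.map M.outputAlphabet.invFun (f a)).length + 1) + t a + 1
      ≤ time (ea a).length
    omega

theorem exists_length_le_time (M : TM2ComputableInTime ea id f) :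
    ∃ c : ℕ, ∀ a, (f a).length ≤ (ea a).length + c * M.time (ea a).length := by
  obtain ⟨c, hc⟩ := exists_output_length_le M.tm
  refine ⟨c, fun a => ?_⟩
  have := hc _ _ _ (M.outputsFun a).evals_in_steps
  simp only [List.length_map, id] at this
  exact this.trans (Nat.add_le_add_left (Nat.mul_le_mul_left _ (M.outputsFun a).steps_le_m) _)

end computable

end QCirc

end

noncomputable section

namespace QCirc

open Turing Function

/-! ### The program that writes the description of the sampling circuit -/

namespace Prog

variable {K : Type} [DecidableEq K]

/-- The program `p` leads from `T` to `T'` in at most `B` steps. -/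
def Runs (p : Prog K) (T T' : K → List Bool) (B : ℕ) : Prop := ∃ t ≤ B, p.Exec T T' t

theorem Runs.mono {p : Prog K} {T T' : K → List Bool} {B B' : ℕ} (h : p.Runs T T' B)
    (hB : B ≤ B') : p.Runs T T' B' := by
  obtain ⟨t, ht, h⟩ := h
  exact ⟨t, ht.trans hB, h⟩

theorem Runs.emit {k : K} {w : List Bool} {T T' : K → List Bool}
    (h : update T k (w.reverse ++ T k) = T') : (Prog.emit k w).Runs T T' 1 :=
  ⟨1, le_rfl, h ▸ Exec.emit k w T⟩

theorem Runs.seq {p q : Prog K} {T₀ T₁ T₂ : K → List Bool} {B₁ B₂ : ℕ} (h₁ : p.Runs T₀ T₁ B₁)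
    (h₂ : q.Runs T₁ T₂ B₂) : (Prog.seq p q).Runs T₀ T₂ (B₁ + B₂) := by
  obtain ⟨t₁, ht₁, h₁⟩ := h₁
  obtain ⟨t₂, ht₂, h₂⟩ := h₂
  exact ⟨_, add_le_add ht₁ ht₂, h₁.seq h₂⟩

theorem Runs.loop_nil {k : K} {p q : Prog K} {T : K → List Bool} (h : T k = []) :
    (loop k p q).Runs T T 1 := ⟨1, le_rfl, .loop_nil h⟩

theorem Runs.loop_true {k : K} {p q : Prog K} {T T₀ T₁ T₂ : K → List Bool} {l : List Bool}
    {B₁ B₂ : ℕ} (h : T k = true :: l) (hT : update T k l = T₀) (h₁ : p.Runs T₀ T₁ B₁)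
    (h₂ : (loop k p q).Runs T₁ T₂ B₂) : (loop k p q).Runs T T₂ (1 + B₁ + B₂) := by
  obtain ⟨t₁, ht₁, h₁⟩ := h₁
  obtain ⟨t₂, ht₂, h₂⟩ := h₂
  subst hT
  exact ⟨1 + t₁ + t₂, by omega, .loop_true h h₁ h₂⟩

theorem Runs.loop_false {k : K} {p q : Prog K} {T T₀ T₁ T₂ : K → List Bool} {l : List Bool}
    {B₁ B₂ : ℕ} (h : T k = false :: l) (hT : update T k l = T₀) (h₁ : q.Runs T₀ T₁ B₁)
    (h₂ : (loop k p q).Runs T₁ T₂ B₂) : (loop k p q).Runs T T₂ (1 + B₁ + B₂) := by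
  obtain ⟨t₁, ht₁, h₁⟩ := h₁
  obtain ⟨t₂, ht₂, h₂⟩ := h₂
  subst hT
  exact ⟨1 + t₁ + t₂, by omega, .loop_false h h₁ h₂⟩

theorem Runs.while_nil {k : K} {p : Prog K} {T : K → List Bool} (h : T k = []) :
    (whileTrue k p).Runs T T 1 := ⟨1, le_rfl, .while_nil h⟩

theorem Runs.while_true {k : K} {p : Prog K} {T T₀ T₁ T₂ : K → List Bool} {l : List Bool}
    {B₁ B₂ : ℕ} (h : T k = true :: l) (hT : update T k l = T₀) (h₁ : p.Runs T₀ T₁ B₁)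
    (h₂ : (whileTrue k p).Runs T₁ T₂ B₂) : (whileTrue k p).Runs T T₂ (1 + B₁ + B₂) := by
  obtain ⟨t₁, ht₁, h₁⟩ := h₁
  obtain ⟨t₂, ht₂, h₂⟩ := h₂
  subst hT
  exact ⟨1 + t₁ + t₂, by omega, .while_true h h₁ h₂⟩

theorem Runs.while_false {k : K} {p : Prog K} {T T' : K → List Bool} {l : List Bool}
    (h : T k = false :: l) (hT : update T k l = T') : (whileTrue k p).Runs T T' 1 :=
  ⟨1, le_rfl, hT ▸ .while_false h⟩

end Prog

/-! ### The stacks, the text of the program and its intended output -/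

/-- The stacks of the program: input and final output, two counters, two auxiliary stacks and the
reversed output. -/
inductive Stk : Type
  | i | u | q | t | s | x
  deriving DecidableEq

namespace Stk

instance : Fintype Stk := ⟨{.i, .u, .q, .t, .s, .x}, fun k => by cases k <;> decide⟩

/-- The contents of all stacks. -/
def cfg (i u q t s x : List Bool) : Stk → List Bool
  | .i => i
  | .u => u
  | .q => q
  | .t => t
  | .s => s
  | .x => x

variable (i u q t s x w : List Bool)

@[simp] theorem cfg_s : cfg i u q t s x .s = s := rfl

@[simp] theorem update_cfg_i : update (cfg i u q t s x) .i w = cfg w u q t s x := by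
  funext k; cases k <;> rfl
@[simp] theorem update_cfg_u : update (cfg i u q t s x) .u w = cfg i w q t s x := by
  funext k; cases k <;> rfl
@[simp] theorem update_cfg_q : update (cfg i u q t s x) .q w = cfg i u w t s x := by
  funext k; cases k <;> rfl
@[simp] theorem update_cfg_t : update (cfg i u q t s x) .t w = cfg i u q w s x := by
  funext k; cases k <;> rfl
@[simp] theorem update_cfg_s : update (cfg i u q t s x) .s w = cfg i u q t w x := by
  funext k; cases k <;> rfl
@[simp] theorem update_cfg_x : update (cfg i u q t s x) .x w = cfg i u q t s w := by
  funext k; cases k <;> rfl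

theorem nil_eq_cfg : (fun _ : Stk => ([] : List Bool)) = cfg [] [] [] [] [] [] := by
  funext k; cases k <;> rfl

end Stk

/-- The `m`-fold repetition of a word. -/
def rep {α : Type*} (m : ℕ) (w : List α) : List α := (List.replicate m w).flatten

@[simp] theorem rep_zero {α : Type*} (w : List α) : rep 0 w = [] := rfl

theorem rep_succ {α : Type*} (m : ℕ) (w : List α) : rep (m + 1) w = w ++ rep m w := by
  simp [rep, List.replicate_succ]

theorem rep_add {α : Type*} (m n : ℕ) (w : List α) : rep (m + n) w = rep m w ++ rep n w := by
  induction m with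
  | zero => simp
  | succ m ih => rw [add_right_comm, rep_succ, rep_succ, ih, List.append_assoc]

theorem rep_comm {α : Type*} (m : ℕ) (w : List α) : rep m w ++ w = w ++ rep m w := by
  rw [← rep_succ, rep_add]; simp [rep_succ]

theorem rep_append_self {α : Type*} (m : ℕ) (w : List α) : rep m (w ++ w) = rep (2 * m) w := by
  induction m with
  | zero => rfl
  | succ m ih => rw [rep_succ, ih, mul_add, mul_one, rep_succ, rep_succ, List.append_assoc]

theorem rep_reverse {α : Type*} (m : ℕ) (w : List α) : (rep m w).reverse = rep m w.reverse := by
  induction m with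
  | zero => rfl
  | succ m ih => rw [rep_succ, List.reverse_append, ih, rep_comm, ← rep_succ]

theorem length_rep {α : Type*} (m : ℕ) (w : List α) : (rep m w).length = m * w.length := by
  simp [rep]

open Prog

/-- Move a stack onto another one, reversing it. -/
def moveProg (k k' : Stk) : Prog Stk := loop k (emit k' [true]) (emit k' [false])

/-- Push a word on the output stack, once for every letter of the unary counter `k`. -/
def emitRep (k : Stk) (w : List Bool) : Prog Stk :=
  seq (whileTrue k (seq (emit .t [true]) (emit .s w))) (whileTrue .t (emit k [true]))

/-- The descriptions of the auxiliary gates. -/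
structure GateWords where
  (idw prep trace bell rot sel : List Bool)

namespace GateWords

variable (g : GateWords)

/-- Write the layers that prepare pairs of entangled qubits. -/
def pairsProg : Prog Stk :=
  seq (emitRep .u (g.idw ++ g.prep ++ g.prep)) <| seq (emit .s [false]) <|
  seq (emitRep .u (g.idw ++ g.bell)) (emit .s [false])

/-- Write the layers that move the second halves of the pairs to the front. -/
def rotProg : Prog Stk :=
  whileTrue .u <|
    seq (emitRep .q g.idw) <| seq (emit .s g.rot) <| seq (emitRep .u g.rot) <|
    seq (emitRep .q (g.idw ++ g.idw)) <| seq (emit .s [false]) (emit .q [true])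

/-- Copy the layers of the given circuit, with the identity on further qubits. -/
def copyProg : Prog Stk :=
  loop .i (seq (emit .s [true]) (seq (whileTrue .i (emit .s [true])) (emit .s [false])))
    (seq (emitRep .q (g.idw ++ g.idw)) (emit .s [false]))

/-- Write the layers that select one of two strings. -/
def selProg : Prog Stk :=
  whileTrue .q <|
    seq (emitRep .u (g.idw ++ g.idw)) <| seq (emit .s g.sel) <|
    seq (emitRep .q (g.idw ++ g.idw)) <| seq (emit .s [false]) (emit .u [true])

/-- Write the layer that discards the string not selected. -/
def discardProg : Prog Stk :=
  seq (emitRep .u (g.idw ++ g.trace)) (emit .s (g.trace ++ [false]))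

/-- Double the output. -/
def doubleProg : Prog Stk :=
  seq (moveProg .s .t) <|
  seq (loop .t (seq (emit .s [true]) (emit .x [true])) (seq (emit .s [false]) (emit .x [false]))) <|
  seq (moveProg .x .t) (moveProg .t .s)

/-- Double the output as often as the counter says. -/
def powerProg : Prog Stk := whileTrue .u (seq doubleProg (emit .q [true]))

/-- Reverse the output and put the layer that prepares the initial string in front of it. -/
def finishProg : Prog Stk :=
  seq (moveProg .s .i) <| seq (emit .i [false]) <| seq (whileTrue .q (emit .i g.prep.reverse))
    (emit .i [false])

/-- Write the description of one round. -/
def roundProg : Prog Stk :=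
  seq (moveProg .t .i) <| seq (whileTrue .i (emit .u [true])) <| seq g.pairsProg <|
  seq g.rotProg <| seq g.copyProg <| seq g.selProg g.discardProg

/-- The whole program. -/
def sampleProg : Prog Stk := seq g.roundProg (seq powerProg g.finishProg)

/-- What `rotProg` writes. -/
def rotWord : ℕ → ℕ → List Bool
  | _, 0 => []
  | k, j + 1 => rep k g.idw ++ rep (j + 1) g.rot ++ rep k (g.idw ++ g.idw) ++ [false] ++
      rotWord (k + 1) j

/-- What `selProg` writes. -/
def selWord : ℕ → ℕ → List Bool
  | _, 0 => []
  | k, j + 1 => rep k (g.idw ++ g.idw) ++ g.sel ++ rep j (g.idw ++ g.idw) ++ [false] ++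
      selWord (k + 1) j

/-- The description of the gate of number `i`. -/
def gateCode (i : ℕ) : List Bool := List.replicate (i + 1) true ++ [false]

/-- The description of a list of layers, followed by `w` in each layer. -/
def layersWord (w : List Bool) (Ls : List (List ℕ)) : List Bool :=
  Ls.flatMap fun L => L.flatMap gateCode ++ w ++ [false]

/-- The description of one round. -/
def roundWord (m : ℕ) (Ls : List (List ℕ)) : List Bool :=
  rep m (g.idw ++ g.prep ++ g.prep) ++ [false] ++ (rep m (g.idw ++ g.bell) ++ [false]) ++
    g.rotWord 0 m ++ layersWord (rep m (g.idw ++ g.idw)) Ls ++ g.selWord 0 m ++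
    (rep m (g.idw ++ g.trace) ++ (g.trace ++ [false]))

/-- The output of the program. -/
def sampleWord (m : ℕ) (Ls : List (List ℕ)) : List Bool :=
  [false] ++ rep m g.prep ++ [false] ++ rep (2 ^ m) (g.roundWord m Ls)

end GateWords

/-! ### Correctness and running time of the program -/

open Stk

local notation "𝟏" => fun n : ℕ => List.replicate n true

theorem replicate_append_cons {α : Type*} (m : ℕ) (a : α) (l : List α) :
    List.replicate m a ++ a :: l = List.replicate (m + 1) a ++ l := by
  rw [List.replicate_succ', List.append_assoc]; rfl

theorem runs_emit_i (w : List Bool) {i u q t s x : List Bool} :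
    (emit .i w).Runs (cfg i u q t s x) (cfg (w.reverse ++ i) u q t s x) 1 :=
  Runs.emit (update_cfg_i ..)

theorem runs_emit_u (w : List Bool) {i u q t s x : List Bool} :
    (emit .u w).Runs (cfg i u q t s x) (cfg i (w.reverse ++ u) q t s x) 1 :=
  Runs.emit (update_cfg_u ..)

theorem runs_emit_q (w : List Bool) {i u q t s x : List Bool} :
    (emit .q w).Runs (cfg i u q t s x) (cfg i u (w.reverse ++ q) t s x) 1 :=
  Runs.emit (update_cfg_q ..)

theorem runs_emit_s (w : List Bool) {i u q t s x : List Bool} :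
    (emit .s w).Runs (cfg i u q t s x) (cfg i u q t (w.reverse ++ s) x) 1 :=
  Runs.emit (update_cfg_s ..)

/-- Draining the counter onto the empty stack `t` while writing takes `3 * m + 1` steps, restoring
it `2 * m + 1`. The counter survives, so it can be used again. -/
theorem runs_emitRep_u (w : List Bool) (m : ℕ) (i q s x : List Bool) :
    (emitRep .u w).Runs (cfg i (𝟏 m) q [] s x) (cfg i (𝟏 m) q [] ((rep m w).reverse ++ s) x)
      (5 * m + 2) := by
  have h₁ : ∀ (m : ℕ) (t s : List Bool), (whileTrue .u (seq (emit .t [true]) (emit .s w))).Runs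
      (cfg i (𝟏 m) q t s x) (cfg i [] q (𝟏 m ++ t) ((rep m w).reverse ++ s) x) (3 * m + 1) := by
    intro m
    induction m with
    | zero => intro t s; exact Runs.while_nil rfl
    | succ m ih =>
      intro t s
      have h := ih (true :: t) (w.reverse ++ s)
      rw [replicate_append_cons, ← List.append_assoc, ← List.reverse_append, ← rep_succ] at h
      exact Runs.mono (Runs.while_true (l := 𝟏 m) rfl (update_cfg_u ..) ((Runs.emit (update_cfg_t ..)).seq
        (Runs.emit (update_cfg_s ..))) h) (by omega)
  have h₂ : ∀ (m : ℕ) (u s : List Bool), (whileTrue .t (emit .u [true])).Runs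
      (cfg i u q (𝟏 m) s x) (cfg i (𝟏 m ++ u) q [] s x) (2 * m + 1) := by
    intro m
    induction m with
    | zero => intro u s; exact Runs.while_nil rfl
    | succ m ih =>
      intro u s
      have h := ih (true :: u) s
      rw [replicate_append_cons] at h
      exact Runs.mono (Runs.while_true (l := 𝟏 m) rfl (update_cfg_t ..) (Runs.emit (update_cfg_u ..))
        h) (by omega)
  have h₃ := h₁ m [] s
  have h₄ := h₂ m [] ((rep m w).reverse ++ s)
  rw [List.append_nil] at h₃ h₄
  exact Runs.mono (h₃.seq h₄) (by omega)

theorem runs_emitRep_q (w : List Bool) (m : ℕ) (i u s x : List Bool) :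
    (emitRep .q w).Runs (cfg i u (𝟏 m) [] s x) (cfg i u (𝟏 m) [] ((rep m w).reverse ++ s) x)
      (5 * m + 2) := by
  have h₁ : ∀ (m : ℕ) (t s : List Bool), (whileTrue .q (seq (emit .t [true]) (emit .s w))).Runs
      (cfg i u (𝟏 m) t s x) (cfg i u [] (𝟏 m ++ t) ((rep m w).reverse ++ s) x) (3 * m + 1) := by
    intro m
    induction m with
    | zero => intro t s; exact Runs.while_nil rfl
    | succ m ih =>
      intro t s
      have h := ih (true :: t) (w.reverse ++ s)
      rw [replicate_append_cons, ← List.append_assoc, ← List.reverse_append, ← rep_succ] at h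
      exact Runs.mono (Runs.while_true (l := 𝟏 m) rfl (update_cfg_q ..) ((Runs.emit (update_cfg_t ..)).seq
        (Runs.emit (update_cfg_s ..))) h) (by omega)
  have h₂ : ∀ (m : ℕ) (q s : List Bool), (whileTrue .t (emit .q [true])).Runs
      (cfg i u q (𝟏 m) s x) (cfg i u (𝟏 m ++ q) [] s x) (2 * m + 1) := by
    intro m
    induction m with
    | zero => intro q s; exact Runs.while_nil rfl
    | succ m ih =>
      intro q s
      have h := ih (true :: q) s
      rw [replicate_append_cons] at h
      exact Runs.mono (Runs.while_true (l := 𝟏 m) rfl (update_cfg_t ..) (Runs.emit (update_cfg_q ..))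
        h) (by omega)
  have h₃ := h₁ m [] s
  have h₄ := h₂ m [] ((rep m w).reverse ++ s)
  rw [List.append_nil] at h₃ h₄
  exact Runs.mono (h₃.seq h₄) (by omega)

theorem runs_move_ti (i u q t s x : List Bool) :
    (moveProg .t .i).Runs (cfg i u q t s x) (cfg (t.reverse ++ i) u q [] s x) (2 * t.length + 1) := by
  induction t generalizing i with
  | nil => exact Runs.loop_nil rfl
  | cons b t ih =>
    have h := ih (b :: i)
    rw [List.append_cons, ← List.reverse_cons] at h
    cases b
    · exact Runs.mono (Runs.loop_false rfl (update_cfg_t ..) (Runs.emit (update_cfg_i ..)) h)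
        (by rw [List.length_cons]; omega)
    · exact Runs.mono (Runs.loop_true rfl (update_cfg_t ..) (Runs.emit (update_cfg_i ..)) h)
        (by rw [List.length_cons]; omega)

theorem runs_move_st (i u q t s x : List Bool) :
    (moveProg .s .t).Runs (cfg i u q t s x) (cfg i u q (s.reverse ++ t) [] x) (2 * s.length + 1) := by
  induction s generalizing t with
  | nil => exact Runs.loop_nil rfl
  | cons b s ih =>
    have h := ih (b :: t)
    rw [List.append_cons, ← List.reverse_cons] at h
    cases b
    · exact Runs.mono (Runs.loop_false rfl (update_cfg_s ..) (Runs.emit (update_cfg_t ..)) h)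
        (by rw [List.length_cons]; omega)
    · exact Runs.mono (Runs.loop_true rfl (update_cfg_s ..) (Runs.emit (update_cfg_t ..)) h)
        (by rw [List.length_cons]; omega)

theorem runs_move_xt (i u q t s x : List Bool) :
    (moveProg .x .t).Runs (cfg i u q t s x) (cfg i u q (x.reverse ++ t) s []) (2 * x.length + 1) := by
  induction x generalizing t with
  | nil => exact Runs.loop_nil rfl
  | cons b x ih =>
    have h := ih (b :: t)
    rw [List.append_cons, ← List.reverse_cons] at h
    cases b
    · exact Runs.mono (Runs.loop_false rfl (update_cfg_x ..) (Runs.emit (update_cfg_t ..)) h)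
        (by rw [List.length_cons]; omega)
    · exact Runs.mono (Runs.loop_true rfl (update_cfg_x ..) (Runs.emit (update_cfg_t ..)) h)
        (by rw [List.length_cons]; omega)

theorem runs_move_ts (i u q t s x : List Bool) :
    (moveProg .t .s).Runs (cfg i u q t s x) (cfg i u q [] (t.reverse ++ s) x) (2 * t.length + 1) := by
  induction t generalizing s with
  | nil => exact Runs.loop_nil rfl
  | cons b t ih =>
    have h := ih (b :: s)
    rw [List.append_cons, ← List.reverse_cons] at h
    cases b
    · exact Runs.mono (Runs.loop_false rfl (update_cfg_t ..) (Runs.emit (update_cfg_s ..)) h)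
        (by rw [List.length_cons]; omega)
    · exact Runs.mono (Runs.loop_true rfl (update_cfg_t ..) (Runs.emit (update_cfg_s ..)) h)
        (by rw [List.length_cons]; omega)

theorem runs_move_si (i u q t s x : List Bool) :
    (moveProg .s .i).Runs (cfg i u q t s x) (cfg (s.reverse ++ i) u q t [] x) (2 * s.length + 1) := by
  induction s generalizing i with
  | nil => exact Runs.loop_nil rfl
  | cons b s ih =>
    have h := ih (b :: i)
    rw [List.append_cons, ← List.reverse_cons] at h
    cases b
    · exact Runs.mono (Runs.loop_false rfl (update_cfg_s ..) (Runs.emit (update_cfg_i ..)) h)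
        (by rw [List.length_cons]; omega)
    · exact Runs.mono (Runs.loop_true rfl (update_cfg_s ..) (Runs.emit (update_cfg_i ..)) h)
        (by rw [List.length_cons]; omega)

/-- The word goes to `t`, from there to both `s` and `x`, and the copy on `x` returns to `s` through
`t`; every transfer reverses, and the number of reversals of either copy is even. -/
theorem runs_doubleProg (u q s : List Bool) :
    GateWords.doubleProg.Runs (cfg [] u q [] s []) (cfg [] u q [] (s ++ s) []) (9 * s.length + 4) := by
  have h : ∀ (t s x : List Bool), (loop .t (seq (emit .s [true]) (emit .x [true]))
      (seq (emit .s [false]) (emit .x [false]))).Runs (cfg [] u q t s x)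
      (cfg [] u q [] (t.reverse ++ s) (t.reverse ++ x)) (3 * t.length + 1) := by
    intro t
    induction t with
    | nil => intro s x; exact Runs.loop_nil rfl
    | cons b t ih =>
      intro s x
      have h := ih (b :: s) (b :: x)
      rw [List.append_cons, ← List.reverse_cons, List.append_cons _ b x, ← List.reverse_cons] at h
      cases b
      · exact Runs.mono (Runs.loop_false rfl (update_cfg_t ..) ((Runs.emit (update_cfg_s ..)).seq
          (Runs.emit (update_cfg_x ..))) h) (by rw [List.length_cons]; omega)
      · exact Runs.mono (Runs.loop_true rfl (update_cfg_t ..) ((Runs.emit (update_cfg_s ..)).seq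
          (Runs.emit (update_cfg_x ..))) h) (by rw [List.length_cons]; omega)
  have h₁ := runs_move_st [] u q [] s []
  have h₂ := h s.reverse [] []
  have h₃ := runs_move_xt [] u q [] s s
  have h₄ := runs_move_ts [] u q s.reverse s []
  simp only [List.append_nil, List.reverse_reverse, List.length_reverse] at h₁ h₂ h₃ h₄
  exact Runs.mono (h₁.seq (h₂.seq (h₃.seq h₄))) (by omega)

theorem runs_powerProg (m : ℕ) (q s : List Bool) :
    GateWords.powerProg.Runs (cfg [] (𝟏 m) q [] s []) (cfg [] [] (𝟏 m ++ q) [] (rep (2 ^ m) s) [])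
      (m * (9 * (2 ^ m * s.length) + 6) + 1) := by
  induction m generalizing q s with
  | zero =>
    have h : rep (2 ^ 0) s = s := by simp [rep]
    rw [h]
    exact Runs.mono (Runs.while_nil rfl) (by omega)
  | succ m ih =>
    have h := ih (true :: q) (s ++ s)
    rw [replicate_append_cons, rep_append_self, ← pow_succ'] at h
    refine Runs.mono (Runs.while_true (l := 𝟏 m) rfl (update_cfg_u ..) ((runs_doubleProg _ _ s).seq
      (Runs.emit (update_cfg_q ..))) h) ?_
    -- Each of the doublings is charged the length of the final word.
    have h₁ : s.length ≤ 2 ^ (m + 1) * s.length := Nat.le_mul_of_pos_left _ (by positivity)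
    have h₂ : 2 ^ m * (s ++ s).length = 2 ^ (m + 1) * s.length := by
      rw [List.length_append, pow_succ]; ring
    rw [h₂, add_mul]
    omega

theorem runs_read (m : ℕ) (l u q t s x : List Bool) :
    (whileTrue .i (emit .u [true])).Runs (cfg (𝟏 m ++ false :: l) u q t s x)
      (cfg l (𝟏 m ++ u) q t s x) (2 * m + 1) := by
  induction m generalizing u with
  | zero => exact Runs.while_false rfl (update_cfg_i ..)
  | succ m ih =>
    have h := ih (true :: u)
    rw [replicate_append_cons] at h
    exact Runs.mono (Runs.while_true (l := 𝟏 m ++ false :: l) rfl (update_cfg_i ..)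
      (Runs.emit (update_cfg_u ..)) h) (by omega)

namespace GateWords

variable (g : GateWords)

theorem runs_pairsProg (m : ℕ) (i q s x : List Bool) :
    g.pairsProg.Runs (cfg i (𝟏 m) q [] s x) (cfg i (𝟏 m) q []
      ((rep m (g.idw ++ g.prep ++ g.prep) ++ [false] ++
        (rep m (g.idw ++ g.bell) ++ [false])).reverse ++ s) x) (10 * m + 6) := by
  have h := (runs_emitRep_u (g.idw ++ g.prep ++ g.prep) m i q s x).seq
    ((runs_emit_s [false]).seq ((runs_emitRep_u (g.idw ++ g.bell) m i q _ x).seq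
      (runs_emit_s [false])))
  rw [List.reverse_append, List.reverse_append, List.reverse_append (bs := [false]),
    List.append_assoc, List.append_assoc, List.append_assoc]
  exact Runs.mono h (by omega)

/-- Invariant: `u` counts the layers still to be written, `q` those written. Their sum is constant,
so `M` bounds the cost of every pass. -/
theorem runs_rotProg (M j k : ℕ) (hM : j + k ≤ M) (i s x : List Bool) :
    g.rotProg.Runs (cfg i (𝟏 j) (𝟏 k) [] s x)
      (cfg i [] (𝟏 (k + j)) [] ((g.rotWord k j).reverse ++ s) x) (j * (15 * M + 10) + 1) := by
  induction j generalizing k s with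
  | zero => exact Runs.mono (Runs.while_nil rfl) (by omega)
  | succ j ih =>
    have h := ih (k + 1) (by omega) ((rep k g.idw ++ rep (j + 1) g.rot ++ rep k (g.idw ++ g.idw) ++
      [false]).reverse ++ s)
    have hb := (runs_emitRep_q g.idw k i (𝟏 j) s x).seq
      ((runs_emit_s g.rot).seq ((runs_emitRep_u g.rot j i (𝟏 k) _ x).seq
      ((runs_emitRep_q (g.idw ++ g.idw) k i (𝟏 j) _ x).seq
      ((runs_emit_s [false]).seq (runs_emit_q [true])))))
    have hs : ((rep k g.idw ++ rep (j + 1) g.rot ++ rep k (g.idw ++ g.idw) ++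
        [false]).reverse ++ s) = [false].reverse ++ ((rep k (g.idw ++ g.idw)).reverse ++
          ((rep j g.rot).reverse ++ (g.rot.reverse ++ ((rep k g.idw).reverse ++ s)))) := by
      simp only [rep_succ, List.reverse_append, List.append_assoc]
    have he : (g.rotWord k (j + 1)).reverse ++ s = (g.rotWord (k + 1) j).reverse ++
        ((rep k g.idw ++ rep (j + 1) g.rot ++ rep k (g.idw ++ g.idw) ++ [false]).reverse ++ s) := by
      rw [rotWord]
      simp only [List.reverse_append, List.append_assoc]
    rw [← hs] at hb
    rw [he, show k + (j + 1) = k + 1 + j by omega]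
    exact Runs.mono (Runs.while_true (l := 𝟏 j) rfl (update_cfg_u ..) hb h)
      (by rw [add_mul]; omega)

theorem runs_selProg (M j k : ℕ) (hM : j + k ≤ M) (i s x : List Bool) :
    g.selProg.Runs (cfg i (𝟏 k) (𝟏 j) [] s x)
      (cfg i (𝟏 (k + j)) [] [] ((g.selWord k j).reverse ++ s) x) (j * (10 * M + 8) + 1) := by
  induction j generalizing k s with
  | zero => exact Runs.mono (Runs.while_nil rfl) (by omega)
  | succ j ih =>
    have h := ih (k + 1) (by omega) ((rep k (g.idw ++ g.idw) ++ g.sel ++ rep j (g.idw ++ g.idw) ++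
      [false]).reverse ++ s)
    have hb := (runs_emitRep_u (g.idw ++ g.idw) k i (𝟏 j) s x).seq
      ((runs_emit_s g.sel).seq ((runs_emitRep_q (g.idw ++ g.idw) j i (𝟏 k) _ x).seq
      ((runs_emit_s [false]).seq (runs_emit_u [true]))))
    have hs : ((rep k (g.idw ++ g.idw) ++ g.sel ++ rep j (g.idw ++ g.idw) ++
        [false]).reverse ++ s) = [false].reverse ++ ((rep j (g.idw ++ g.idw)).reverse ++
          (g.sel.reverse ++ ((rep k (g.idw ++ g.idw)).reverse ++ s))) := by
      simp only [List.reverse_append, List.append_assoc]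
    have he : (g.selWord k (j + 1)).reverse ++ s = (g.selWord (k + 1) j).reverse ++
        ((rep k (g.idw ++ g.idw) ++ g.sel ++ rep j (g.idw ++ g.idw) ++ [false]).reverse ++ s) := by
      rw [selWord]
      simp only [List.reverse_append, List.append_assoc]
    rw [← hs] at hb
    rw [he, show k + (j + 1) = k + 1 + j by omega]
    exact Runs.mono (Runs.while_true (l := 𝟏 j) rfl (update_cfg_q ..) hb h)
      (by rw [add_mul]; omega)

theorem runs_discardProg (m : ℕ) (i q s x : List Bool) :
    g.discardProg.Runs (cfg i (𝟏 m) q [] s x) (cfg i (𝟏 m) q []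
      ((rep m (g.idw ++ g.trace) ++ (g.trace ++ [false])).reverse ++ s) x) (5 * m + 3) := by
  have h := (runs_emitRep_u (g.idw ++ g.trace) m i q s x).seq (runs_emit_s (g.trace ++ [false]))
  rw [List.reverse_append (as := rep m _), List.append_assoc]
  exact Runs.mono h (by omega)

theorem runs_copyGate (a : ℕ) (l u q t s x : List Bool) :
    (whileTrue .i (emit .s [true])).Runs (cfg (𝟏 a ++ false :: l) u q t s x)
      (cfg l u q t (𝟏 a ++ s) x) (2 * a + 1) := by
  induction a generalizing s with
  | zero => exact Runs.while_false rfl (update_cfg_i ..)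
  | succ a ih =>
    have h := ih (true :: s)
    rw [replicate_append_cons] at h
    exact Runs.mono (Runs.while_true (l := 𝟏 a ++ false :: l) rfl (update_cfg_i ..)
      (Runs.emit (update_cfg_s ..)) h) (by omega)

/-- Every gate code starts with a `1`, so a `0` met where a code could start ends the layer; the
identities on the further qubits are inserted there. Stated with the rest of the run as a
hypothesis, so that layers can be chained. -/
theorem runs_copyProg_layer (m : ℕ) (L : List ℕ) (l u s x : List Bool) {T : Stk → List Bool} {B : ℕ}
    (h : g.copyProg.Runs (cfg l u (𝟏 m) [] ((L.flatMap gateCode ++ rep m (g.idw ++ g.idw) ++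
      [false]).reverse ++ s) x) T B) :
    g.copyProg.Runs (cfg (L.flatMap gateCode ++ [false] ++ l) u (𝟏 m) [] s x) T
      ((L.flatMap gateCode ++ [false]).length * (5 * m + 4) + B) := by
  induction L generalizing s with
  | nil =>
    refine Runs.mono (Runs.loop_false rfl (update_cfg_i ..)
      ((runs_emitRep_q (g.idw ++ g.idw) m _ u s x).seq (runs_emit_s [false])) ?_)
      (B := 1 + (5 * m + 2 + 1) + B) (by simp; omega)
    simpa [copyProg] using h
  | cons a L ih =>
    have h' := ih ((gateCode a).reverse ++ s) (by simpa using h)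
    have hs : (gateCode a).reverse ++ s = [false].reverse ++ (𝟏 a ++ ([true].reverse ++ s)) := by
      simp [gateCode, replicate_append_cons]
    rw [hs] at h'
    have hi : (a :: L).flatMap gateCode ++ [false] ++ l = true :: (𝟏 a ++ false ::
        (L.flatMap gateCode ++ [false] ++ l)) := by
      simp [gateCode, List.replicate_succ]
    rw [hi]
    refine Runs.mono (Runs.loop_true rfl (update_cfg_i ..)
      ((runs_emit_s [true]).seq ((runs_copyGate a _ u (𝟏 m) [] _ x).seq (runs_emit_s [false]))) h') ?_
    have hl : ((a :: L).flatMap gateCode ++ [false]).length =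
        (a + 2) + (L.flatMap gateCode ++ [false]).length := by
      simp [gateCode]; omega
    have : (a + 2) * 4 ≤ (a + 2) * (5 * m + 4) := Nat.mul_le_mul_left _ (by omega)
    rw [hl, add_mul]
    omega

theorem runs_copyProg (m : ℕ) (Ls : List (List ℕ)) (u s x : List Bool) :
    g.copyProg.Runs (cfg (layersWord [] Ls) u (𝟏 m) [] s x)
      (cfg [] u (𝟏 m) [] ((layersWord (rep m (g.idw ++ g.idw)) Ls).reverse ++ s) x)
      ((layersWord [] Ls).length * (5 * m + 4) + 1) := by
  induction Ls generalizing s with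
  | nil => exact Runs.mono (Runs.loop_nil rfl) (by omega)
  | cons L Ls ih =>
    have h := g.runs_copyProg_layer m L _ u s x (ih _)
    have hi : layersWord [] (L :: Ls) = L.flatMap gateCode ++ [false] ++ layersWord [] Ls := by
      simp [layersWord]
    rw [hi, List.length_append (bs := layersWord [] Ls), add_mul, add_assoc]
    simpa [layersWord] using h

/-- A bound for the number of steps of `roundProg` on an input of length `n`. -/
def roundTime (n : ℕ) : ℕ := 45 * (n + 1) ^ 2

theorem runs_roundProg (m : ℕ) (Ls : List (List ℕ)) (n : ℕ)
    (hn : (𝟏 m ++ [false] ++ layersWord [] Ls).length = n) :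
    g.roundProg.Runs (cfg [] [] [] (𝟏 m ++ [false] ++ layersWord [] Ls).reverse [] [])
      (cfg [] (𝟏 m) [] [] (g.roundWord m Ls).reverse []) (roundTime n) := by
  have h₁ := runs_move_ti [] [] [] (𝟏 m ++ [false] ++ layersWord [] Ls).reverse [] []
  rw [List.reverse_reverse, List.append_nil, List.append_assoc, List.singleton_append] at h₁
  have h₂ := runs_read m (layersWord [] Ls) [] [] [] [] []
  rw [List.append_nil] at h₂
  have h₃ := g.runs_pairsProg m (layersWord [] Ls) [] [] []
  have h₄ := fun s => g.runs_rotProg m m 0 (by omega) (layersWord [] Ls) s []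
  have h₅ := fun s => g.runs_copyProg m Ls [] s []
  have h₆ := fun s => g.runs_selProg m m 0 (by omega) [] s []
  have h₇ := fun s => g.runs_discardProg m [] [] s []
  simp only [zero_add] at h₄ h₆
  have h := h₁.seq (h₂.seq (h₃.seq ((h₄ _).seq ((h₅ _).seq ((h₆ _).seq (h₇ _))))))
  have he : (g.roundWord m Ls).reverse = (rep m (g.idw ++ g.trace) ++ (g.trace ++ [false])).reverse ++
      ((g.selWord 0 m).reverse ++ ((layersWord (rep m (g.idw ++ g.idw)) Ls).reverse ++
      ((g.rotWord 0 m).reverse ++ ((rep m (g.idw ++ g.prep ++ g.prep) ++ [false] ++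
        (rep m (g.idw ++ g.bell) ++ [false])).reverse ++ [])))) := by
    simp only [roundWord, List.reverse_append, List.append_assoc, List.append_nil]
  rw [he]
  rw [List.append_assoc, List.singleton_append]
  refine Runs.mono h ?_
  have hl : (layersWord [] Ls).length ≤ n := by
    rw [← hn, List.length_append]; omega
  have hm : m ≤ n := by
    rw [← hn]; simp
  have hn' : (𝟏 m ++ false :: layersWord [] Ls).reverse.length = n := by
    rw [← hn, List.length_reverse, List.append_assoc, List.singleton_append]
  -- As `m ≤ n`, the seven phases take at most `30 * n ^ 2 + 41 * n + 14` steps in total.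
  have e₁ : m * (15 * m + 10) ≤ n * (15 * n + 10) := by gcongr
  have e₂ : (layersWord [] Ls).length * (5 * m + 4) ≤ n * (5 * n + 4) := by gcongr
  have e₃ : m * (10 * m + 8) ≤ n * (10 * n + 8) := by gcongr
  rw [hn', roundTime]
  nlinarith

/-- A bound for the number of steps of `sampleProg` on an input of length `n` that starts with the
unary number `m`. -/
def sampleTime (n m : ℕ) : ℕ :=
  roundTime n + (m * (9 * (2 ^ m * (g.roundProg.width * roundTime n)) + 6) + 1 +
    (2 * (2 ^ m * (g.roundProg.width * roundTime n)) + 2 * m + 4))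

theorem runs_sampleProg (m : ℕ) (Ls : List (List ℕ)) (n : ℕ)
    (hn : (𝟏 m ++ [false] ++ layersWord [] Ls).length = n) :
    g.sampleProg.Runs (update (fun _ => []) .t (𝟏 m ++ [false] ++ layersWord [] Ls).reverse)
      (update (fun _ => []) .i (g.sampleWord m Ls)) (g.sampleTime n m) := by
  rw [nil_eq_cfg, update_cfg_t, update_cfg_i]
  have h₁ := g.runs_roundProg m Ls n hn
  -- The length of what was written is read off from the running time.
  have hlen : (g.roundWord m Ls).reverse.length ≤ g.roundProg.width * roundTime n := by
    obtain ⟨t, ht, h⟩ := h₁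
    refine (h.length_le .s le_rfl).trans ?_
    simpa using Nat.mul_le_mul_left _ ht
  have h₂ := runs_powerProg m [] (g.roundWord m Ls).reverse
  rw [List.append_nil] at h₂
  have h₃ := runs_move_si [] [] (𝟏 m) [] (rep (2 ^ m) (g.roundWord m Ls).reverse) []
  rw [← rep_reverse, List.reverse_reverse, List.append_nil, List.length_reverse, length_rep,
    ← List.length_reverse (as := g.roundWord m Ls)] at h₃
  rw [← rep_reverse] at h₂
  -- The word is now built from its end on the stack `i`, so each code is pushed reversed in order
  -- to read forwards.
  have h₄ : ∀ (m : ℕ) (i : List Bool), (whileTrue .q (emit .i g.prep.reverse)).Runs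
      (cfg i [] (𝟏 m) [] [] []) (cfg (rep m g.prep ++ i) [] [] [] [] []) (2 * m + 1) := by
    intro m
    induction m with
    | zero => intro i; exact Runs.while_nil rfl
    | succ m ih =>
      intro i
      have h := ih (g.prep ++ i)
      rw [← List.append_assoc, rep_comm, ← rep_succ] at h
      have he := runs_emit_i (i := i) (u := []) (q := 𝟏 m) (t := []) (s := []) (x := [])
        g.prep.reverse
      rw [List.reverse_reverse] at he
      exact Runs.mono (Runs.while_true (l := 𝟏 m) rfl (update_cfg_q ..) he h) (by omega)
  have h := h₁.seq (h₂.seq (h₃.seq ((runs_emit_i [false]).seq ((h₄ m _).seq (runs_emit_i [false])))))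
  have he : g.sampleWord m Ls = [false].reverse ++ (rep m g.prep ++ ([false].reverse ++
      rep (2 ^ m) (g.roundWord m Ls))) := by
    simp [sampleWord]
  rw [he]
  refine Runs.mono h ?_
  have e₁ : m * (9 * (2 ^ m * (g.roundWord m Ls).reverse.length) + 6) ≤
      m * (9 * (2 ^ m * (g.roundProg.width * roundTime n)) + 6) := by gcongr
  have e₂ : 2 ^ m * (g.roundWord m Ls).reverse.length ≤
      2 ^ m * (g.roundProg.width * roundTime n) := by gcongr
  rw [sampleTime]
  omega

end GateWords

end QCirc

end

noncomputable section

namespace QCirc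

/-! ### Matrix elements of channels, indexed by lists of pairs of bits -/

/-- The row indices in a list of pairs. -/
def fstBits (n : ℕ) (x : List (Bool × Bool)) : Bits n := fun i => (x.getD i (false, false)).1

/-- The column indices in a list of pairs. -/
def sndBits (n : ℕ) (x : List (Bool × Bool)) : Bits n := fun i => (x.getD i (false, false)).2

/-- The lists of pairs of bits of length `n`. -/
def strs (n : ℕ) : Finset (List (Bool × Bool)) :=
  Finset.univ.image fun f : Fin n → Bool × Bool => List.ofFn f

@[simp] theorem mem_strs {n : ℕ} {x : List (Bool × Bool)} : x ∈ strs n ↔ x.length = n := by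
  constructor
  · intro h
    obtain ⟨f, -, rfl⟩ := Finset.mem_image.1 h
    simp
  · rintro rfl
    exact Finset.mem_image.2 ⟨x.get, Finset.mem_univ _, List.ofFn_get x⟩

theorem strs_zero : strs 0 = {[]} := by
  ext x; simp

theorem sum_strs_zero {M : Type*} [AddCommMonoid M] (f : List (Bool × Bool) → M) :
    ∑ x ∈ strs 0, f x = f [] := by
  rw [strs_zero, Finset.sum_singleton]

theorem sum_strs_add {M : Type*} [AddCommMonoid M] (m n : ℕ) (f : List (Bool × Bool) → M) :
    ∑ x ∈ strs (m + n), f x = ∑ y ∈ strs m, ∑ z ∈ strs n, f (y ++ z) := by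
  rw [← Finset.sum_product']
  refine Finset.sum_bij' (fun x _ => (x.take m, x.drop m)) (fun p _ => p.1 ++ p.2) ?_ ?_ ?_ ?_ ?_
  · intro x hx
    simp only [mem_strs] at hx
    simp [hx]
  · rintro ⟨y, z⟩ h
    simp only [Finset.mem_product, mem_strs] at h
    simp [h.1, h.2]
  · intro x _
    exact List.take_append_drop _ _
  · rintro ⟨y, z⟩ h
    simp only [Finset.mem_product, mem_strs] at h
    obtain ⟨rfl, -⟩ := h
    simp
  · intro x _
    exact congrArg f (List.take_append_drop _ _).symm

theorem sum_strs_one {M : Type*} [AddCommMonoid M] (f : List (Bool × Bool) → M) :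
    ∑ x ∈ strs 1, f x = ∑ a : Bool × Bool, f [a] := by
  refine (Finset.sum_bij (fun a _ => [a]) (by simp) (by simp) ?_ (by simp)).symm
  intro x hx
  obtain ⟨a, rfl⟩ := List.length_eq_one_iff.1 (mem_strs.1 hx)
  exact ⟨a, by simp⟩

theorem sum_strs_succ {M : Type*} [AddCommMonoid M] (n : ℕ) (f : List (Bool × Bool) → M) :
    ∑ x ∈ strs (n + 1), f x = ∑ a : Bool × Bool, ∑ z ∈ strs n, f (a :: z) := by
  rw [add_comm, sum_strs_add, sum_strs_one]
  rfl

theorem sum_strs_eq_sum_bits {M : Type*} [AddCommMonoid M] (n : ℕ) (f : Bits n → Bits n → M) :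
    ∑ x ∈ strs n, f (fstBits n x) (sndBits n x) = ∑ i, ∑ j, f i j := by
  rw [strs, Finset.sum_image fun _ _ _ _ h => List.ofFn_injective h, ← Fintype.sum_prod_type']
  refine Fintype.sum_equiv (Equiv.arrowProdEquivProdArrow (Fin n) (fun _ => Bool) (fun _ => Bool)) _ _ ?_
  intro q
  congr 1 <;> funext i <;> simp [fstBits, sndBits, Equiv.arrowProdEquivProdArrow]

theorem bits_ext {n : ℕ} {x y : List (Bool × Bool)} (hx : x.length = n) (hy : y.length = n) :
    fstBits n x = fstBits n y ∧ sndBits n x = sndBits n y ↔ x = y := by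
  refine ⟨fun ⟨h₁, h₂⟩ => ?_, fun h => by subst h; exact ⟨rfl, rfl⟩⟩
  refine List.ext_getElem (hx.trans hy.symm) fun i hi hi' => ?_
  have h₁ := congrFun h₁ ⟨i, hx ▸ hi⟩
  have h₂ := congrFun h₂ ⟨i, hx ▸ hi⟩
  simp only [fstBits, sndBits, List.getD_eq_getElem _ _ hi, List.getD_eq_getElem _ _ hi'] at h₁ h₂
  exact Prod.ext h₁ h₂

/-- The matrix elements of a linear map on operators. -/
def ker {a b : ℕ} (Φ : SuperOp a b) (x y : List (Bool × Bool)) : ℂ :=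
  Φ (Matrix.single (fstBits a x) (sndBits a x) 1) (fstBits b y) (sndBits b y)

theorem ker_id {a : ℕ} {x y : List (Bool × Bool)} (hx : x.length = a) (hy : y.length = a) :
    ker (LinearMap.id : SuperOp a a) x y = if x = y then 1 else 0 := by
  simp only [ker, LinearMap.id_apply, Matrix.single_apply, bits_ext hx hy]

theorem comp_single_apply {a b c : ℕ} (Φ : SuperOp a b) (Ψ : SuperOp b c) (i i' : Bits a)
    (y y' : Bits c) : (Ψ ∘ₗ Φ) (Matrix.single i i' 1) y y' =
      ∑ z, ∑ z', Φ (Matrix.single i i' 1) z z' * Ψ (Matrix.single z z' 1) y y' := by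
  rw [LinearMap.comp_apply]
  conv_lhs => rw [Matrix.matrix_eq_sum_single (Φ (Matrix.single i i' 1))]
  simp only [map_sum, Matrix.sum_apply]
  refine Finset.sum_congr rfl fun i _ => Finset.sum_congr rfl fun j _ => ?_
  have : ∀ r : ℂ, Matrix.single i j r = r • Matrix.single i j (1 : ℂ) := fun r => by
    rw [Matrix.smul_single, smul_eq_mul, mul_one]
  rw [this, map_smul, Matrix.smul_apply, smul_eq_mul]

theorem ker_comp {a b c : ℕ} (Φ : SuperOp a b) (Ψ : SuperOp b c) (x y : List (Bool × Bool)) :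
    ker (Ψ ∘ₗ Φ) x y = ∑ z ∈ strs b, ker Φ x z * ker Ψ z y := by
  simp only [ker]
  rw [sum_strs_eq_sum_bits b fun i j => Φ (Matrix.single (fstBits a x) (sndBits a x) 1) i j *
    Ψ (Matrix.single i j 1) (fstBits c y) (sndBits c y), comp_single_apply]

theorem operatorTensor_tmul_apply (a c : ℕ) (A : Operator a) (B : Operator c)
    (y y' : Bits (a + c)) : operatorTensor a c (A ⊗ₜ[ℂ] B) y y' =
      A (splitBits a c y).1 (splitBits a c y').1 * B (splitBits a c y).2 (splitBits a c y').2 := by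
  simp [operatorTensor]

theorem operatorTensor_single (a c : ℕ) (i i' : Bits (a + c)) :
    operatorTensor a c (Matrix.single (splitBits a c i).1 (splitBits a c i').1 (1 : ℂ) ⊗ₜ[ℂ]
      Matrix.single (splitBits a c i).2 (splitBits a c i').2 (1 : ℂ)) = Matrix.single i i' 1 := by
  ext y y'
  rw [operatorTensor_tmul_apply]
  simp only [Matrix.single_apply]
  have h : ∀ i y : Bits (a + c), i = y ↔ (splitBits a c i).1 = (splitBits a c y).1 ∧
      (splitBits a c i).2 = (splitBits a c y).2 := fun i y => by
    rw [← Prod.ext_iff, (splitBits a c).injective.eq_iff]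
  rw [ite_zero_mul_ite_zero, mul_one]
  refine if_congr ?_ rfl rfl
  rw [h i, h i']
  tauto

theorem tensor_single_apply {a b c d : ℕ} (Φ : SuperOp a b) (Ψ : SuperOp c d) (i i' : Bits (a + c))
    (y y' : Bits (b + d)) : SuperOp.tensor Φ Ψ (Matrix.single i i' 1) y y' =
      Φ (Matrix.single (splitBits a c i).1 (splitBits a c i').1 1)
        (splitBits b d y).1 (splitBits b d y').1 *
      Ψ (Matrix.single (splitBits a c i).2 (splitBits a c i').2 1)
        (splitBits b d y).2 (splitBits b d y').2 := by
  rw [← operatorTensor_single]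
  simp [SuperOp.tensor, operatorTensor_tmul_apply]

theorem splitBits_fstBits {a c : ℕ} {x x' : List (Bool × Bool)} (hx : x.length = a) :
    splitBits a c (fstBits (a + c) (x ++ x')) = (fstBits a x, fstBits c x') := by
  subst hx
  ext i <;> simp [splitBits, fstBits, Equiv.sumArrowEquivProdArrow, Equiv.arrowCongr, List.getElem?_append]

theorem splitBits_sndBits {a c : ℕ} {x x' : List (Bool × Bool)} (hx : x.length = a) :
    splitBits a c (sndBits (a + c) (x ++ x')) = (sndBits a x, sndBits c x') := by
  subst hx
  ext i <;> simp [splitBits, sndBits, Equiv.sumArrowEquivProdArrow, Equiv.arrowCongr, List.getElem?_append]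

/-- With lists as indices a Kronecker product splits along a concatenation, and no cast between
qubit counts is needed. -/
theorem ker_tensor {a b c d : ℕ} (Φ : SuperOp a b) (Ψ : SuperOp c d)
    {x x' y y' : List (Bool × Bool)} (hx : x.length = a) (hy : y.length = b) :
    ker (SuperOp.tensor Φ Ψ) (x ++ x') (y ++ y') = ker Φ x y * ker Ψ x' y' := by
  simp only [ker, tensor_single_apply, splitBits_fstBits hx, splitBits_sndBits hx,
    splitBits_fstBits hy, splitBits_sndBits hy]

/-- The matrix elements of a gate. -/
def gateKer (g : Gate) : List (Bool × Bool) → List (Bool × Bool) → ℂ := ker g.channel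

/-- The matrix elements of a layer. -/
def layerKer {G : GateSet} (L : Layer G) : List (Bool × Bool) → List (Bool × Bool) → ℂ :=
  ker (Layer.channel L)

theorem layerKer_cons {G : GateSet} (i : Fin G.length) (L : Layer G)
    {x x' y y' : List (Bool × Bool)} (hx : x.length = (G.get i).inputs)
    (hy : y.length = (G.get i).outputs) :
    layerKer (G := G) (i :: L) (x ++ x') (y ++ y') = gateKer (G.get i) x y * layerKer L x' y' :=
  ker_tensor _ _ hx hy

theorem layerKer_nil {G : GateSet} : layerKer ([] : Layer G) [] [] = 1 := by
  rw [layerKer, Layer.channel]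
  exact (ker_id (a := 0) rfl rfl).trans (if_pos rfl)

theorem inputs_append {G : GateSet} (L M : Layer G) :
    Layer.inputs (L ++ M : Layer G) = Layer.inputs L + Layer.inputs M := by
  induction L with
  | nil => simp [Layer.inputs]
  | cons i L ih => simp only [List.cons_append, Layer.inputs] at ih ⊢; omega

theorem outputs_append {G : GateSet} (L M : Layer G) :
    Layer.outputs (L ++ M : Layer G) = Layer.outputs L + Layer.outputs M := by
  induction L with
  | nil => simp [Layer.outputs]
  | cons i L ih => simp only [List.cons_append, Layer.outputs] at ih ⊢; omega

theorem layerKer_append {G : GateSet} (L M : Layer G) {x x' y y' : List (Bool × Bool)}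
    (hx : x.length = Layer.inputs L) (hy : y.length = Layer.outputs L) :
    layerKer (G := G) (L ++ M) (x ++ x') (y ++ y') = layerKer L x y * layerKer M x' y' := by
  induction L generalizing x y with
  | nil =>
    obtain rfl := List.length_eq_zero_iff.1 hx
    obtain rfl := List.length_eq_zero_iff.1 hy
    simp [layerKer_nil]
  | cons i L ih =>
    simp only [Layer.inputs, Layer.outputs] at hx hy
    obtain ⟨x₁, x₂, rfl, hx₁, hx₂⟩ : ∃ x₁ x₂, x = x₁ ++ x₂ ∧ x₁.length = (G.get i).inputs ∧
        x₂.length = Layer.inputs L :=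
      ⟨x.take (G.get i).inputs, x.drop (G.get i).inputs, (List.take_append_drop _ _).symm,
        by rw [List.length_take]; omega, by rw [List.length_drop]; omega⟩
    obtain ⟨y₁, y₂, rfl, hy₁, hy₂⟩ : ∃ y₁ y₂, y = y₁ ++ y₂ ∧ y₁.length = (G.get i).outputs ∧
        y₂.length = Layer.outputs L :=
      ⟨y.take (G.get i).outputs, y.drop (G.get i).outputs, (List.take_append_drop _ _).symm,
        by rw [List.length_take]; omega, by rw [List.length_drop]; omega⟩
    rw [List.append_assoc, List.append_assoc, List.cons_append, layerKer_cons i _ hx₁ hy₁,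
      layerKer_cons i _ hx₁ hy₁, ih hx₂ hy₂, mul_assoc]

/-! ### Matrix elements of sequences of layers -/

/-- `Ls` is a sequence of composable layers from `a` qubits to `b` qubits. -/
inductive Composable {G : GateSet} : ℕ → List (Layer G) → ℕ → Prop
  | nil (a : ℕ) : Composable a [] a
  | cons {b : ℕ} (L : Layer G) {Ls : List (Layer G)} : Composable (Layer.outputs L) Ls b →
      Composable (Layer.inputs L) (L :: Ls) b

theorem Circuit.composable {G : GateSet} {a b : ℕ} (C : Circuit G a b) :
    Composable a C.layers b := by
  induction C with
  | nil a => exact .nil a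
  | cons L C ih => exact .cons L ih

/-- Allows the sampling circuit to be assembled as a plain list of layers, with the matching of
qubit counts as a proposition. -/
theorem Composable.exists_circuit {G : GateSet} {a b : ℕ} {Ls : List (Layer G)}
    (h : Composable a Ls b) : ∃ C : Circuit G a b, C.layers = Ls := by
  induction h with
  | nil a => exact ⟨.nil a, rfl⟩
  | cons L h ih =>
    obtain ⟨C, rfl⟩ := ih
    exact ⟨.cons L C, rfl⟩

theorem Composable.append {G : GateSet} {a b c : ℕ} {Ls Ms : List (Layer G)}
    (h : Composable a Ls b) (h' : Composable b Ms c) : Composable a (Ls ++ Ms) c := by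
  induction h with
  | nil a => exact h'
  | cons L h ih => exact .cons L (ih h')

theorem Composable.single {G : GateSet} {a b : ℕ} (L : Layer G) (ha : Layer.inputs L = a)
    (hb : Layer.outputs L = b) : Composable a [L] b := by
  subst ha hb
  exact .cons L (.nil _)

/-- The matrix elements of a sequence of layers. -/
def layersKer {G : GateSet} : List (Layer G) → List (Bool × Bool) → List (Bool × Bool) → ℂ
  | [], x, y => if x = y then 1 else 0
  | L :: Ls, x, y => ∑ z ∈ strs (Layer.outputs L), layerKer L x z * layersKer Ls z y

theorem Circuit.ker_channel {G : GateSet} {a b : ℕ} (C : Circuit G a b)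
    {x y : List (Bool × Bool)} (hx : x.length = a) (hy : y.length = b) :
    ker C.channel x y = layersKer C.layers x y := by
  induction C generalizing x with
  | nil a => exact ker_id hx hy
  | cons L C ih =>
    rw [Circuit.channel, ker_comp, Circuit.layers, layersKer]
    exact Finset.sum_congr rfl fun z hz => by rw [ih (mem_strs.1 hz) hy]; rfl

theorem layersKer_append {G : GateSet} {a b : ℕ} {Ls : List (Layer G)} (h : Composable a Ls b)
    (Ms : List (Layer G)) {x : List (Bool × Bool)} (hx : x.length = a) (y : List (Bool × Bool)) :
    layersKer (Ls ++ Ms) x y = ∑ z ∈ strs b, layersKer Ls x z * layersKer Ms z y := by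
  induction h generalizing x with
  | nil a =>
    simp only [layersKer, List.nil_append, ite_mul, one_mul, zero_mul]
    rw [Finset.sum_ite_eq, if_pos (mem_strs.2 hx)]
  | cons L h ih =>
    simp only [List.cons_append, layersKer, Finset.sum_mul]
    rw [Finset.sum_comm]
    refine Finset.sum_congr rfl fun z hz => ?_
    rw [ih (mem_strs.1 hz), Finset.mul_sum]
    simp only [mul_assoc]

/-! ### The auxiliary gates -/

theorem gateKer_unitary {k : ℕ} {U : Operator k} (hU halg) (x y : List (Bool × Bool)) :
    gateKer (.unitary k U hU halg) x y =
      U (fstBits k y) (fstBits k x) * star (U (sndBits k y) (sndBits k x)) := by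
  simp [gateKer, ker, Gate.channel, Matrix.mul_apply, Matrix.single_apply, ite_and]

/-- The matrix of a permutation of the bit strings. -/
def permMat {k : ℕ} (f : Equiv.Perm (Bits k)) : Operator k :=
  Matrix.of fun y x => if y = f x then 1 else 0

/-- The gate that permutes the bit strings. -/
def permGate {k : ℕ} (f : Equiv.Perm (Bits k)) : Gate :=
  .unitary k (permMat f)
    (by
      rw [Matrix.mem_unitaryGroup_iff']
      ext x x'
      simp [permMat, Matrix.mul_apply, Matrix.star_apply, Matrix.one_apply, eq_comm])
    (by
      intro x y
      simp only [permMat, Matrix.of_apply]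
      split_ifs
      · exact isAlgebraic_one
      · exact isAlgebraic_zero)

/-- Conjugation by a permutation matrix acts on row and column indices separately, so it permutes
matrix units, off-diagonal ones included. -/
theorem gateKer_permGate {k : ℕ} (f : Equiv.Perm (Bits k)) {x z w : List (Bool × Bool)}
    (hz : z.length = k) (hw : w.length = k) (h₁ : fstBits k w = f (fstBits k x))
    (h₂ : sndBits k w = f (sndBits k x)) :
    gateKer (permGate f) x z = if z = w then 1 else 0 := by
  rw [permGate, gateKer_unitary]
  simp only [permMat, Matrix.of_apply, ← h₁, ← h₂, RCLike.star_def, apply_ite (starRingEnd ℂ),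
    map_one, map_zero, ite_zero_mul_ite_zero, mul_one]
  exact if_congr (bits_ext hz hw) rfl rfl

/-- `(x, a, b) ↦ (b, x, a)`. -/
def rotPerm : Equiv.Perm (Bits 3) where
  toFun v := ![v 2, v 0, v 1]
  invFun v := ![v 1, v 2, v 0]
  left_inv := by decide
  right_inv := by decide

/-- `(c, x, a) ↦ (x, a, c)` if `c = 0`, and `(c, x, a) ↦ (a, x, c)` if `c = 1`. -/
def selPerm : Equiv.Perm (Bits 3) where
  toFun v := ![if v 0 then v 2 else v 1, if v 0 then v 1 else v 2, v 0]
  invFun v := ![v 2, if v 2 then v 1 else v 0, if v 2 then v 0 else v 1]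
  left_inv := by decide
  right_inv := by decide

/-- The matrix of a unitary that maps `|00⟩` to a maximally entangled state. -/
def bellMat : Operator 2 :=
  -- A Hadamard gate on the first qubit, with sign `(-1)^(x₀ y₀)`, followed by a controlled NOT onto
  -- the second.
  Matrix.of fun y x => if xor (y 0) (y 1) = x 1 then
    (if x 0 && y 0 then -1 else 1) * (Real.sqrt 2 : ℂ)⁻¹ else 0

theorem inv_sqrt_two_mul_self : (Real.sqrt 2 : ℂ)⁻¹ * (Real.sqrt 2 : ℂ)⁻¹ = 1 / 2 := by
  rw [← mul_inv, ← Complex.ofReal_mul, Real.mul_self_sqrt (by norm_num)]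
  norm_num

/-- The gate that maps `|00⟩` to a maximally entangled state. -/
def bellGate : Gate :=
  .unitary 2 bellMat
    (by
      rw [Matrix.mem_unitaryGroup_iff]
      ext y y'
      rw [Matrix.mul_apply, Fintype.sum_equiv (finTwoArrowEquiv Bool) _ (fun p : Bool × Bool =>
        bellMat y ![p.1, p.2] * star bellMat ![p.1, p.2] y') (fun x => by
          congr 2; funext i; fin_cases i <;> rfl)]
      obtain ⟨a, b, rfl⟩ : ∃ a b, y = ![a, b] := ⟨y 0, y 1, by funext i; fin_cases i <;> rfl⟩
      obtain ⟨a', b', rfl⟩ : ∃ a b, y' = ![a, b] := ⟨y' 0, y' 1, by funext i; fin_cases i <;> rfl⟩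
      have h := inv_sqrt_two_mul_self
      cases a <;> cases b <;> cases a' <;> cases b' <;>
        simp [bellMat, Fintype.sum_prod_type, Matrix.star_apply, h] <;> norm_num)
    (by
      have h : IsAlgebraic ℚ (Real.sqrt 2 : ℂ)⁻¹ := by
        refine (IsAlgebraic.of_pow (n := 2) (by norm_num) ?_).inv
        rw [← Complex.ofReal_pow, Real.sq_sqrt (by norm_num)]
        exact_mod_cast isAlgebraic_algebraMap (A := ℂ) (2 : ℚ)
      intro x y
      simp only [bellMat, Matrix.of_apply]
      split_ifs
      · simpa using h.neg
      · simpa using h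
      · exact isAlgebraic_zero)

theorem fstBits_three (p q r : Bool × Bool) : fstBits 3 [p, q, r] = ![p.1, q.1, r.1] := by
  funext i; fin_cases i <;> rfl

theorem sndBits_three (p q r : Bool × Bool) : sndBits 3 [p, q, r] = ![p.2, q.2, r.2] := by
  funext i; fin_cases i <;> rfl

theorem gateKer_rot (x a b : Bool × Bool) {z : List (Bool × Bool)} (hz : z.length = 3) :
    gateKer (permGate rotPerm) [x, a, b] z = if z = [b, x, a] then 1 else 0 := by
  refine gateKer_permGate _ hz rfl ?_ ?_
  · rw [fstBits_three, fstBits_three]; rfl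
  · rw [sndBits_three, sndBits_three]; rfl

/-- Choose the entries of `a` or `x` according to `c`. -/
def select (c x a : Bool × Bool) : Bool × Bool :=
  (if c.1 then a.1 else x.1, if c.2 then a.2 else x.2)

theorem gateKer_sel (c x a : Bool × Bool) {z : List (Bool × Bool)} (hz : z.length = 3) :
    gateKer (permGate selPerm) [c, x, a] z =
      if z = [select c x a, select c a x, c] then 1 else 0 := by
  refine gateKer_permGate _ hz rfl ?_ ?_
  · rw [fstBits_three, fstBits_three]; rfl
  · rw [sndBits_three, sndBits_three]; rfl

theorem gateKer_one (x : Bool × Bool) {z : List (Bool × Bool)} (hz : z.length = 1) :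
    gateKer (permGate (1 : Equiv.Perm (Bits 1))) [x] z = if z = [x] then 1 else 0 :=
  gateKer_permGate _ hz rfl rfl rfl

theorem gateKer_prep {z : List (Bool × Bool)} (hz : z.length = 1) :
    gateKer .prep [] z = if z = [(false, false)] then 1 else 0 := by
  have hx : fstBits 0 [] = sndBits 0 [] := Subsingleton.elim _ _
  have h₁ : (fun _ => false : Bits 1) = fstBits 1 [(false, false)] :=
    funext fun i => by fin_cases i; rfl
  have h₂ : (fun _ => false : Bits 1) = sndBits 1 [(false, false)] :=
    funext fun i => by fin_cases i; rfl
  simp only [gateKer, ker, Gate.channel, LinearMap.smulRight_apply, Matrix.traceLinearMap_apply, hx,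
    Matrix.trace_single_eq_same, one_smul, ketbra, Matrix.single_apply]
  refine if_congr ?_ rfl rfl
  rw [← bits_ext hz rfl, ← h₁, ← h₂, eq_comm (b := fstBits 1 z), eq_comm (b := sndBits 1 z)]

theorem gateKer_trace (x : Bool × Bool) : gateKer .trace [x] [] = if x.1 = x.2 then 1 else 0 := by
  have h : fstBits 1 [x] = sndBits 1 [x] ↔ x.1 = x.2 :=
    ⟨fun h => congrFun h 0, fun h => funext fun i => by fin_cases i; exact h⟩
  have hy : fstBits 0 [] = sndBits 0 [] := Subsingleton.elim _ _
  simp only [gateKer, ker, Gate.channel, LinearMap.smulRight_apply, Matrix.traceLinearMap_apply,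
    Matrix.smul_apply, smul_eq_mul, Matrix.one_apply, hy, if_true, mul_one]
  by_cases hx : x.1 = x.2
  · rw [if_pos hx, h.2 hx, Matrix.trace_single_eq_same]
  · rw [if_neg hx, Matrix.trace_single_eq_of_ne _ _ _ (fun e => hx (h.1 e))]

/-- The value `1 / 2` is the product of two amplitudes `1 / √2`. Coherences, that is pairs with
distinct components, occur too; later traces remove them. -/
theorem gateKer_bell (a b : Bool × Bool) :
    gateKer bellGate [(false, false), (false, false)] [a, b] = if a = b then 1 / 2 else 0 := by
  obtain ⟨a, a'⟩ := a
  obtain ⟨b, b'⟩ := b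
  have h := inv_sqrt_two_mul_self
  rw [bellGate, gateKer_unitary]
  cases a <;> cases b <;> cases a' <;> cases b' <;>
    simp [bellMat, fstBits, sndBits, h]

/-! ### The layers of the sampling circuit -/

/-- The gate set extended by the auxiliary gates. -/
def extGates (G : GateSet) : GateSet :=
  G ++ [permGate (1 : Equiv.Perm (Bits 1)), .prep, .trace, bellGate, permGate rotPerm,
    permGate selPerm]

section indices

variable (G : GateSet)

theorem length_extGates : (extGates G).length = G.length + 6 := by simp [extGates]

/-- A gate of `G` as a gate of the extended gate set. -/
def oldIx (i : Fin G.length) : Fin (extGates G).length :=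
  ⟨i, by rw [length_extGates]; omega⟩

/-- The auxiliary gate of number `j`. -/
def newIx (j : Fin 6) : Fin (extGates G).length :=
  ⟨G.length + j, by rw [length_extGates]; omega⟩

theorem get_oldIx (i : Fin G.length) : (extGates G).get (oldIx G i) = G.get i := by
  simp [oldIx, extGates, List.getElem_append_left]

theorem get_newIx (j : Fin 6) : (extGates G).get (newIx G j) =
    ![permGate (1 : Equiv.Perm (Bits 1)), .prep, .trace, bellGate, permGate rotPerm,
      permGate selPerm] j := by
  simp only [newIx, extGates, List.get_eq_getElem]
  rw [List.getElem_append_right (by simp)]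
  fin_cases j <;> simp

end indices

variable {G : GateSet}

theorem layerKer_singleton (i : Fin G.length) {x y : List (Bool × Bool)}
    (hx : x.length = (G.get i).inputs) (hy : y.length = (G.get i).outputs) :
    layerKer (G := G) [i] x y = gateKer (G.get i) x y := by
  have h := layerKer_cons i [] (x' := []) (y' := []) hx hy
  rwa [List.append_nil, List.append_nil, layerKer_nil, mul_one] at h

/-- The layer `L` maps the basis element `x` to the basis element `z`. -/
structure Det (L : Layer G) (x z : List (Bool × Bool)) : Prop where
  hin : x.length = Layer.inputs L
  hout : z.length = Layer.outputs L
  eq : ∀ y, y.length = Layer.outputs L → layerKer L x y = if y = z then 1 else 0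

theorem Det.nil : Det ([] : Layer G) [] [] where
  hin := rfl
  hout := rfl
  eq y hy := by
    obtain rfl := List.length_eq_zero_iff.1 hy
    rw [layerKer_nil, if_pos rfl]

theorem exists_append_of_length_eq_add {α : Type*} {y : List α} {m n : ℕ} (h : y.length = m + n) :
    ∃ y₁ y₂, y = y₁ ++ y₂ ∧ y₁.length = m ∧ y₂.length = n :=
  ⟨y.take m, y.drop m, (List.take_append_drop _ _).symm, by rw [List.length_take]; omega,
    by rw [List.length_drop]; omega⟩

theorem Det.append {L M : Layer G} {x z x' z' : List (Bool × Bool)} (h : Det L x z)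
    (h' : Det M x' z') : Det (L ++ M) (x ++ x') (z ++ z') where
  hin := by rw [inputs_append, List.length_append, h.hin, h'.hin]
  hout := by rw [outputs_append, List.length_append, h.hout, h'.hout]
  eq y hy := by
    rw [outputs_append] at hy
    obtain ⟨y₁, y₂, rfl, h₁, h₂⟩ := exists_append_of_length_eq_add hy
    rw [layerKer_append L M h.hin h₁, h.eq _ h₁, h'.eq _ h₂, ite_zero_mul_ite_zero, mul_one]
    refine if_congr ?_ rfl rfl
    rw [List.append_eq_append_iff_of_size_eq_left (h₁.trans h.hout.symm)]

/-- The sum over intermediate indices has a single nonzero term, so deterministic layers merely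
rewrite the index. -/
theorem Det.layersKer_cons {L : Layer G} {x z : List (Bool × Bool)} (h : Det L x z)
    (Ls : List (Layer G)) (y : List (Bool × Bool)) :
    layersKer (L :: Ls) x y = layersKer Ls z y := by
  rw [layersKer, Finset.sum_eq_single_of_mem z (mem_strs.2 h.hout)]
  · rw [h.eq _ h.hout, if_pos rfl, one_mul]
  · intro w hw hne
    rw [h.eq _ (mem_strs.1 hw), if_neg hne, zero_mul]

theorem inputs_singleton (i : Fin G.length) :
    Layer.inputs ([i] : Layer G) = (G.get i).inputs := rfl

theorem outputs_singleton (i : Fin G.length) :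
    Layer.outputs ([i] : Layer G) = (G.get i).outputs := rfl

theorem det_gate {i : Fin G.length} {g : Gate} (hg : G.get i = g) {x z : List (Bool × Bool)}
    (hx : x.length = g.inputs) (hz : z.length = g.outputs)
    (h : ∀ y, y.length = g.outputs → gateKer g x y = if y = z then 1 else 0) : Det [i] x z := by
  subst hg
  exact ⟨hx, hz, fun y hy => (layerKer_singleton i hx hy).trans (h y hy)⟩

variable (G)

theorem det_id (x : Bool × Bool) : Det [newIx G 0] [x] [x] :=
  det_gate (get_newIx G 0) rfl rfl fun _ hy => gateKer_one x hy

theorem det_prep : Det [newIx G 1] [] [(false, false)] :=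
  det_gate (get_newIx G 1) rfl rfl fun _ hy => gateKer_prep hy

theorem det_rot (x a b : Bool × Bool) : Det [newIx G 4] [x, a, b] [b, x, a] :=
  det_gate (get_newIx G 4) rfl rfl fun _ hy => gateKer_rot x a b hy

theorem det_sel (c x a : Bool × Bool) :
    Det [newIx G 5] [c, x, a] [select c x a, select c a x, c] :=
  det_gate (get_newIx G 5) rfl rfl fun _ hy => gateKer_sel c x a hy

theorem det_ids (k : ℕ) {x : List (Bool × Bool)} (hx : x.length = k) :
    Det (rep k [newIx G 0]) x x := by
  induction x generalizing k with
  | nil => subst hx; exact Det.nil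
  | cons a x ih =>
    subst hx
    rw [List.length_cons, rep_succ]
    exact (det_id G a).append (ih _ rfl)

theorem det_id_pairs (k : ℕ) {x : List (Bool × Bool)} (hx : x.length = 2 * k) :
    Det (rep k [newIx G 0, newIx G 0]) x x := by
  have h := det_ids G _ hx
  rwa [← rep_append_self] at h

/-! ### The layers of a round and their matrix elements -/

/-- The list `x₁, a₁, b₁, x₂, a₂, b₂, …`. -/
def triples {α : Type*} : List α → List α → List α → List α
  | x :: X, a :: A, b :: B => x :: a :: b :: triples X A B
  | _, _, _ => []

/-- The list `x₁, a₁, x₂, a₂, …`. -/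
def pairs {α : Type*} : List α → List α → List α
  | x :: X, a :: A => x :: a :: pairs X A
  | _, _ => []

theorem length_pairs {α : Type*} {n : ℕ} {X A : List α} (hX : X.length = n) (hA : A.length = n) :
    (pairs X A).length = 2 * n := by
  induction X generalizing A n with
  | nil => subst hX; simp [pairs]
  | cons x X ih =>
    subst hX
    obtain ⟨a, A, rfl⟩ := List.exists_cons_of_length_eq_add_one hA
    simp only [pairs, List.length_cons] at hA ⊢
    rw [ih rfl (by omega)]
    omega

theorem pairs_concat {α : Type*} {X A : List α} (h : X.length = A.length) (x a : α) :
    pairs (X ++ [x]) (A ++ [a]) = pairs X A ++ [x, a] := by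
  induction X generalizing A with
  | nil =>
    obtain rfl := List.length_eq_zero_iff.1 h.symm
    rfl
  | cons y X ih =>
    obtain ⟨b, A, rfl⟩ := List.exists_cons_of_length_eq_add_one h.symm
    simp only [List.cons_append, pairs]
    rw [ih (by simpa using h)]

/-- The first layer of a round: two new qubits after each qubit. -/
def prepLayer (m : ℕ) : Layer (extGates G) := rep m [newIx G 0, newIx G 1, newIx G 1]

/-- The second layer of a round: entangle the new qubits. -/
def bellLayer (m : ℕ) : Layer (extGates G) := rep m [newIx G 0, newIx G 3]

/-- One of the layers that move one qubit of each triple to the front. -/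
def rotLayer (k j : ℕ) : Layer (extGates G) :=
  rep k [newIx G 0] ++ rep j [newIx G 4] ++ rep k [newIx G 0, newIx G 0]

/-- The layers that move one qubit of each triple to the front. -/
def rotLayers : ℕ → ℕ → List (Layer (extGates G))
  | _, 0 => []
  | k, j + 1 => rotLayer G k (j + 1) :: rotLayers (k + 1) j

/-- One of the layers that swap the members of each pair if the control qubit is set. -/
def selLayer (k j : ℕ) : Layer (extGates G) :=
  rep k [newIx G 0, newIx G 0] ++ [newIx G 5] ++ rep j [newIx G 0, newIx G 0]

/-- The layers that swap the members of each pair if the control qubit is set. -/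
def selLayers : ℕ → ℕ → List (Layer (extGates G))
  | _, 0 => []
  | k, j + 1 => selLayer G k j :: selLayers (k + 1) j

/-- The last layer of a round: discard the second members of the pairs and the control qubit. -/
def discardLayer (m : ℕ) : Layer (extGates G) := rep m [newIx G 0, newIx G 2] ++ [newIx G 2]

variable {G}

/-- The layers of a circuit over `G`, with the identity on `2 * m` further qubits. -/
def copyLayers (m : ℕ) (Ls : List (Layer G)) : List (Layer (extGates G)) :=
  Ls.map fun L => (L.map (oldIx G) ++ rep m [newIx G 0, newIx G 0] : Layer (extGates G))

/-- The layers of one round. -/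
def roundLayers (m : ℕ) (Ls : List (Layer G)) : List (Layer (extGates G)) :=
  [prepLayer G m, bellLayer G m] ++ (rotLayers G 0 m ++ (copyLayers m Ls ++ (selLayers G 0 m ++
    [discardLayer G m])))

/-- The layers of the sampling circuit. -/
def sampleLayers (m : ℕ) (Ls : List (Layer G)) : List (Layer (extGates G)) :=
  rep m [newIx G 1] :: rep (2 ^ m) (roundLayers m Ls)

variable (G)

theorem det_prepLayer {m : ℕ} {X : List (Bool × Bool)} (hX : X.length = m) :
    Det (prepLayer G m) X
      (triples X (List.replicate m (false, false)) (List.replicate m (false, false))) := by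
  induction X generalizing m with
  | nil => subst hX; exact Det.nil
  | cons x X ih =>
    subst hX
    rw [List.length_cons, prepLayer, rep_succ]
    exact ((det_id G x).append ((det_prep G).append (det_prep G))).append (ih rfl)

theorem exists_concat_of_length_eq_add_one {α : Type*} {y : List α} {n : ℕ}
    (h : y.length = n + 1) : ∃ y' b, y = y' ++ [b] ∧ y'.length = n := by
  obtain ⟨y', z, rfl, h₁, h₂⟩ := exists_append_of_length_eq_add h
  obtain ⟨b, rfl⟩ := List.length_eq_one_iff.1 h₂
  exact ⟨y', b, rfl, h₁⟩

/-- After each triple is rotated, the first `b` stands in front. Shifting the grouping by one qubit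
makes triples again, each `x, a` now meeting the `b` that followed it; the last `x, a` is left over.
-/
theorem det_rots {n : ℕ} {X A B : List (Bool × Bool)} (hX : X.length = n) (hA : A.length = n)
    (hB : B.length = n) (b x a : Bool × Bool) :
    Det (rep (n + 1) [newIx G 4]) (triples (X ++ [x]) (A ++ [a]) (b :: B))
      (b :: (triples X A B ++ [x, a])) := by
  induction X generalizing n A B b with
  | nil =>
    subst hX
    obtain rfl := List.length_eq_zero_iff.1 hA
    obtain rfl := List.length_eq_zero_iff.1 hB
    exact det_rot G x a b
  | cons x₁ X ih =>
    subst hX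
    obtain ⟨a₁, A, rfl⟩ := List.exists_cons_of_length_eq_add_one hA
    obtain ⟨b₁, B, rfl⟩ := List.exists_cons_of_length_eq_add_one hB
    rw [rep_succ]
    exact (det_rot G x₁ a₁ b).append (ih rfl (by simpa using hA) (by simpa using hB) b₁)

/-- By `det_rots`, each layer appends one `b` to the prefix `P` and prepends one pair `x, a` to the
suffix `S`, leaving one triple fewer in between. -/
theorem layersKer_rotLayers {j k : ℕ} {P X A B S : List (Bool × Bool)} (hP : P.length = k)
    (hX : X.length = j) (hA : A.length = j) (hB : B.length = j) (hS : S.length = 2 * k)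
    (Ls : List (Layer (extGates G))) (y : List (Bool × Bool)) :
    layersKer (rotLayers G k j ++ Ls) (P ++ triples X A B ++ S) y =
      layersKer Ls (P ++ B ++ (pairs X A ++ S)) y := by
  induction j generalizing k P X A B S with
  | zero =>
    obtain rfl := List.length_eq_zero_iff.1 hX
    obtain rfl := List.length_eq_zero_iff.1 hA
    obtain rfl := List.length_eq_zero_iff.1 hB
    simp [rotLayers, triples, pairs]
  | succ j ih =>
    obtain ⟨X, x, rfl, hX'⟩ := exists_concat_of_length_eq_add_one hX
    obtain ⟨A, a, rfl, hA'⟩ := exists_concat_of_length_eq_add_one hA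
    obtain ⟨b, B, rfl⟩ := List.exists_cons_of_length_eq_add_one hB
    replace hB : B.length = j := by simpa using hB
    have h : Det (rotLayer G k (j + 1)) (P ++ triples (X ++ [x]) (A ++ [a]) (b :: B) ++ S)
        (P ++ (b :: (triples X A B ++ [x, a])) ++ S) :=
      ((det_ids G k hP).append (det_rots G hX' hA' hB b x a)).append (det_id_pairs G k hS)
    rw [rotLayers, List.cons_append, h.layersKer_cons]
    have h' := ih (k := k + 1) (P := P ++ [b]) (S := [x, a] ++ S) (by simp [hP]) hX' hA' hB
      (by simp [hS]; omega)
    rw [pairs_concat (hX'.trans hA'.symm)]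
    simpa using h'

/-- The control qubit travels from left to right through the pairs, swapping each one when it is
set, and ends up last. -/
theorem layersKer_selLayers {j k : ℕ} {P X A : List (Bool × Bool)} (hP : P.length = 2 * k)
    (hX : X.length = j) (hA : A.length = j) (c : Bool × Bool)
    (Ls : List (Layer (extGates G))) (y : List (Bool × Bool)) :
    layersKer (selLayers G k j ++ Ls) (P ++ c :: pairs X A) y =
      layersKer Ls (P ++ (pairs (List.zipWith (select c) X A) (List.zipWith (select c) A X) ++ [c]))
        y := by
  induction j generalizing k P X A with
  | zero =>
    obtain rfl := List.length_eq_zero_iff.1 hX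
    obtain rfl := List.length_eq_zero_iff.1 hA
    simp [selLayers, pairs]
  | succ j ih =>
    obtain ⟨x, X, rfl⟩ := List.exists_cons_of_length_eq_add_one hX
    obtain ⟨a, A, rfl⟩ := List.exists_cons_of_length_eq_add_one hA
    replace hX : X.length = j := by simpa using hX
    replace hA : A.length = j := by simpa using hA
    have h : Det (selLayer G k j) (P ++ [c, x, a] ++ pairs X A)
        (P ++ [select c x a, select c a x, c] ++ pairs X A) :=
      ((det_id_pairs G k hP).append (det_sel G c x a)).append
        (det_id_pairs G j (length_pairs hX hA))
    have ih' := ih (k := k + 1) (P := P ++ [select c x a, select c a x]) (by simp [hP]; omega) hX hA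
    simp only [selLayers, List.cons_append, pairs, List.zipWith_cons_cons, List.append_assoc,
      List.nil_append] at h ih' ⊢
    rw [h.layersKer_cons, ih']

/-- All pairs in the list have equal components. -/
def IsDiag (x : List (Bool × Bool)) : Prop := ∀ a ∈ x, a.1 = a.2

instance (x : List (Bool × Bool)) : Decidable (IsDiag x) :=
  inferInstanceAs (Decidable (∀ a ∈ x, a.1 = a.2))

theorem layerKer_trace (x : Bool × Bool) :
    layerKer (G := extGates G) [newIx G 2] [x] [] = if x.1 = x.2 then 1 else 0 := by
  have h := get_newIx G 2
  rw [layerKer_singleton _ (by rw [h]; rfl) (by rw [h]; rfl), h]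
  exact gateKer_trace x

theorem layerKer_id (x y : Bool × Bool) :
    layerKer (G := extGates G) [newIx G 0] [x] [y] = if y = x then 1 else 0 := by
  rw [(det_id G x).eq [y] (by rw [← (det_id G x).hout]; rfl)]
  simp

theorem inputs_newIx (j : Fin 6) : Layer.inputs ([newIx G j] : Layer (extGates G)) =
    ![1, 0, 1, 2, 3, 3] j := by
  rw [inputs_singleton, get_newIx]; fin_cases j <;> rfl

theorem outputs_newIx (j : Fin 6) : Layer.outputs ([newIx G j] : Layer (extGates G)) =
    ![1, 1, 0, 2, 3, 3] j := by
  rw [outputs_singleton, get_newIx]; fin_cases j <;> rfl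

/-- A trace kills matrix units whose row and column differ, whence the diagonality conditions on the
discarded string and the control bit. -/
theorem layerKer_discardLayer {m : ℕ} {X A S : List (Bool × Bool)} (hX : X.length = m)
    (hA : A.length = m) (hS : S.length = m) (c : Bool × Bool) :
    layerKer (discardLayer G m) (pairs X A ++ [c]) S =
      if S = X ∧ IsDiag A ∧ c.1 = c.2 then 1 else 0 := by
  induction X generalizing m A S with
  | nil =>
    subst hX
    obtain rfl := List.length_eq_zero_iff.1 hA
    obtain rfl := List.length_eq_zero_iff.1 hS
    refine (layerKer_trace G c).trans (if_congr ?_ rfl rfl)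
    simp [IsDiag]
  | cons x X ih =>
    subst hX
    obtain ⟨a, A, rfl⟩ := List.exists_cons_of_length_eq_add_one hA
    obtain ⟨s, S, rfl⟩ := List.exists_cons_of_length_eq_add_one hS
    have h₁ := layerKer_append (G := extGates G) [newIx G 2] (discardLayer G X.length)
      (x := [a]) (y := []) (x' := pairs X A ++ [c]) (y' := S) (by rw [inputs_newIx]; rfl)
      (by rw [outputs_newIx]; rfl)
    have h₂ := layerKer_append (G := extGates G) [newIx G 0] ([newIx G 2] ++ discardLayer G X.length)
      (x := [x]) (y := [s]) (x' := [a] ++ (pairs X A ++ [c])) (y' := [] ++ S)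
      (by rw [inputs_newIx]; rfl) (by rw [outputs_newIx]; rfl)
    rw [h₁, layerKer_id, layerKer_trace, ih rfl (by simpa using hA) (by simpa using hS)] at h₂
    have e : discardLayer G (x :: X).length =
        [newIx G 0] ++ ([newIx G 2] ++ discardLayer G X.length) := by
      rw [List.length_cons, discardLayer, rep_succ]; rfl
    rw [e]
    refine h₂.trans ?_
    rw [ite_zero_mul_ite_zero, ite_zero_mul_ite_zero, mul_one, mul_one]
    refine if_congr ?_ rfl rfl
    simp only [List.cons.injEq, IsDiag, List.forall_mem_cons]
    tauto

/-- Each Bell pair contributes two equal indices with weight `1 / 2`; the common string `A` need not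
be diagonal yet. -/
theorem layerKer_bellLayer {m : ℕ} {X Z : List (Bool × Bool)} (hX : X.length = m)
    (hZ : Z.length = 3 * m) :
    layerKer (bellLayer G m)
      (triples X (List.replicate m (false, false)) (List.replicate m (false, false))) Z =
      ∑ A ∈ strs m, if Z = triples X A A then (1 / 2) ^ m else 0 := by
  induction X generalizing m Z with
  | nil =>
    subst hX
    obtain rfl := List.length_eq_zero_iff.1 hZ
    rw [List.length_nil, sum_strs_zero]
    exact (layerKer_nil (G := extGates G)).trans (by simp [triples])
  | cons x X ih =>
    subst hX
    obtain ⟨z, Z, rfl⟩ := List.exists_cons_of_length_eq_add_one (n := 3 * X.length + 2)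
      (by rw [hZ, List.length_cons]; omega)
    obtain ⟨a, Z, rfl⟩ := List.exists_cons_of_length_eq_add_one (l := Z) (n := 3 * X.length + 1)
      (by simp only [List.length_cons] at hZ; omega)
    obtain ⟨b, Z, rfl⟩ := List.exists_cons_of_length_eq_add_one (l := Z) (n := 3 * X.length)
      (by simp only [List.length_cons] at hZ; omega)
    have hb : layerKer (G := extGates G) [newIx G 3] [(false, false), (false, false)] [a, b] =
        if a = b then 1 / 2 else 0 := by
      have h := get_newIx G 3
      rw [layerKer_singleton _ (by rw [h]; rfl) (by rw [h]; rfl), h]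
      exact gateKer_bell a b
    have h₁ := layerKer_append (G := extGates G) [newIx G 3] (bellLayer G X.length)
      (x := [(false, false), (false, false)]) (y := [a, b])
      (x' := triples X (List.replicate X.length (false, false))
        (List.replicate X.length (false, false))) (y' := Z) (by rw [inputs_newIx]; rfl)
      (by rw [outputs_newIx]; rfl)
    have h₂ := layerKer_append (G := extGates G) [newIx G 0] ([newIx G 3] ++ bellLayer G X.length)
      (x := [x]) (y := [z]) (x' := [(false, false), (false, false)] ++
        triples X (List.replicate X.length (false, false))
        (List.replicate X.length (false, false))) (y' := [a, b] ++ Z)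
      (by rw [inputs_newIx]; rfl) (by rw [outputs_newIx]; rfl)
    rw [h₁, layerKer_id, hb, ih rfl (by simp only [List.length_cons] at hZ; omega)] at h₂
    have e : bellLayer G (x :: X).length =
        [newIx G 0] ++ ([newIx G 3] ++ bellLayer G X.length) := by
      rw [List.length_cons, bellLayer, rep_succ]; rfl
    rw [e]
    refine h₂.trans ?_
    -- Only strings `A` beginning with the entry `a` read off from `Z` contribute.
    rw [List.length_cons, sum_strs_succ, Finset.sum_eq_single a]
    · rw [Finset.mul_sum, Finset.mul_sum]
      refine Finset.sum_congr rfl fun A _ => ?_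
      rw [ite_zero_mul_ite_zero, ite_zero_mul_ite_zero, one_mul, pow_succ']
      refine if_congr ?_ rfl rfl
      simp only [triples, List.cons.injEq, true_and, eq_comm (a := b)]
    · intro a' _ hne
      refine Finset.sum_eq_zero fun A _ => if_neg ?_
      simp only [triples, List.cons.injEq, not_and]
      exact fun _ h => absurd h.symm hne
    · simp

theorem inputs_map_oldIx (L : Layer G) :
    Layer.inputs (L.map (oldIx G) : Layer (extGates G)) = Layer.inputs L := by
  induction L with
  | nil => rfl
  | cons i L ih => simp only [List.map_cons, Layer.inputs, get_oldIx]; exact congrArg _ ih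

theorem outputs_map_oldIx (L : Layer G) :
    Layer.outputs (L.map (oldIx G) : Layer (extGates G)) = Layer.outputs L := by
  induction L with
  | nil => rfl
  | cons i L ih => simp only [List.map_cons, Layer.outputs, get_oldIx]; exact congrArg _ ih

theorem layerKer_map_oldIx (L : Layer G) {x y : List (Bool × Bool)}
    (hx : x.length = Layer.inputs L) (hy : y.length = Layer.outputs L) :
    layerKer (G := extGates G) (L.map (oldIx G)) x y = layerKer L x y := by
  induction L generalizing x y with
  | nil =>
    obtain rfl := List.length_eq_zero_iff.1 hx
    obtain rfl := List.length_eq_zero_iff.1 hy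
    rw [layerKer_nil]
    exact layerKer_nil
  | cons i L ih =>
    simp only [Layer.inputs, Layer.outputs] at hx hy
    obtain ⟨x₁, x₂, rfl, hx₁, hx₂⟩ := exists_append_of_length_eq_add hx
    obtain ⟨y₁, y₂, rfl, hy₁, hy₂⟩ := exists_append_of_length_eq_add hy
    rw [List.map_cons, layerKer_cons i L hx₁ hy₁,
      layerKer_cons (oldIx G i) _ (by rw [get_oldIx, hx₁]) (by rw [get_oldIx, hy₁]), get_oldIx,
      ih hx₂ hy₂]

variable {G}

theorem layersKer_copyLayers {a b m : ℕ} {Ls : List (Layer G)} (h : Composable a Ls b)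
    {A U : List (Bool × Bool)} (hA : A.length = a) (hU : U.length = 2 * m)
    (Ms : List (Layer (extGates G))) (y : List (Bool × Bool)) :
    layersKer (copyLayers m Ls ++ Ms) (A ++ U) y =
      ∑ c ∈ strs b, layersKer Ls A c * layersKer Ms (c ++ U) y := by
  induction h generalizing A with
  | nil a =>
    simp only [layersKer, copyLayers, List.map_nil, List.nil_append, ite_mul, one_mul, zero_mul]
    rw [Finset.sum_ite_eq, if_pos (mem_strs.2 hA)]
  | @cons b L Ls h ih =>
    have hd := det_id_pairs G m hU
    have hL : copyLayers m (L :: Ls) ++ Ms =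
      (L.map (oldIx G) ++ rep m [newIx G 0, newIx G 0] : Layer (extGates G)) ::
        (copyLayers m Ls ++ Ms) := rfl
    rw [hL, layersKer, outputs_append, sum_strs_add, outputs_map_oldIx]
    simp only [layersKer, Finset.sum_mul]
    rw [Finset.sum_comm (s := strs b)]
    refine Finset.sum_congr rfl fun z hz => ?_
    rw [mem_strs] at hz
    rw [Finset.sum_eq_single_of_mem U (mem_strs.2 hd.hout)]
    · rw [layerKer_append _ _ (by rw [inputs_map_oldIx, hA]) (by rw [outputs_map_oldIx, hz]),
        hd.eq U hd.hout, if_pos rfl, mul_one, layerKer_map_oldIx _ _ hA hz, ih hz, Finset.mul_sum]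
      simp only [mul_assoc]
    · intro w hw hne
      rw [layerKer_append _ _ (by rw [inputs_map_oldIx, hA]) (by rw [outputs_map_oldIx, hz]),
        hd.eq w (mem_strs.1 hw), if_neg hne, mul_zero, zero_mul]

/-! ### Complete positivity and trace preservation -/

/-- A linear map on operators is a channel if it has a Kraus representation and preserves traces. -/
def IsChannel {a b : ℕ} (Φ : SuperOp a b) : Prop :=
  (∃ (ι : Type) (_ : Fintype ι) (K : ι → Bits b → Bits a → ℂ), ∀ i i' y y',
    Φ (Matrix.single i i' 1) y y' = ∑ k, K k y i * star (K k y' i')) ∧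
  ∀ i i', ∑ y, Φ (Matrix.single i i' 1) y y = if i = i' then 1 else 0

theorem IsChannel.id (a : ℕ) : IsChannel (LinearMap.id : SuperOp a a) := by
  refine ⟨⟨Unit, inferInstance, fun _ y i => if i = y then 1 else 0, fun i i' y y' => ?_⟩,
    fun i i' => ?_⟩
  · simp [Matrix.single_apply, apply_ite (starRingEnd ℂ), ite_and]
    split_ifs <;> rfl
  · simp [Matrix.single_apply, ite_and, eq_comm]

theorem IsChannel.comp {a b c : ℕ} {Φ : SuperOp a b} {Ψ : SuperOp b c} (hΦ : IsChannel Φ)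
    (hΨ : IsChannel Ψ) : IsChannel (Ψ ∘ₗ Φ) := by
  obtain ⟨⟨ι, _, K, hK⟩, hΦ⟩ := hΦ
  obtain ⟨⟨κ, _, L, hL⟩, hΨ⟩ := hΨ
  refine ⟨⟨ι × κ, inferInstance, fun p y i => ∑ z, K p.1 z i * L p.2 y z, fun i i' y y' => ?_⟩,
    fun i i' => ?_⟩
  · rw [comp_single_apply, Fintype.sum_prod_type]
    simp only [hK, hL, star_sum, Finset.sum_mul_sum, star_mul']
    rw [Finset.sum_congr rfl fun z _ => Finset.sum_comm, Finset.sum_comm]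
    refine Finset.sum_congr rfl fun k _ => ?_
    rw [Finset.sum_congr rfl fun z _ => Finset.sum_comm, Finset.sum_comm]
    refine Finset.sum_congr rfl fun l _ => Finset.sum_congr rfl fun z _ =>
      Finset.sum_congr rfl fun z' _ => ?_
    ring
  · simp only [comp_single_apply]
    rw [Finset.sum_comm]
    -- Summing over the final index first lets trace preservation of `Ψ` collapse the intermediate
    -- indices to the diagonal.
    simp_rw [Finset.sum_comm (s := Finset.univ (α := Bits c)), ← Finset.mul_sum, hΨ]
    simp [hΦ]

theorem IsChannel.tensor {a b c d : ℕ} {Φ : SuperOp a b} {Ψ : SuperOp c d} (hΦ : IsChannel Φ)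
    (hΨ : IsChannel Ψ) : IsChannel (SuperOp.tensor Φ Ψ) := by
  obtain ⟨⟨ι, _, K, hK⟩, hΦ⟩ := hΦ
  obtain ⟨⟨κ, _, L, hL⟩, hΨ⟩ := hΨ
  refine ⟨⟨ι × κ, inferInstance, fun p y i => K p.1 (splitBits b d y).1 (splitBits a c i).1 *
    L p.2 (splitBits b d y).2 (splitBits a c i).2, fun i i' y y' => ?_⟩, fun i i' => ?_⟩
  · rw [tensor_single_apply, Fintype.sum_prod_type, hK, hL, Finset.sum_mul_sum]
    refine Finset.sum_congr rfl fun k _ => Finset.sum_congr rfl fun l _ => ?_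
    rw [star_mul']
    ring
  · simp only [tensor_single_apply]
    rw [Fintype.sum_equiv (splitBits b d) _ (fun p =>
      Φ (Matrix.single (splitBits a c i).1 (splitBits a c i').1 1) p.1 p.1 *
      Ψ (Matrix.single (splitBits a c i).2 (splitBits a c i').2 1) p.2 p.2) fun _ => rfl,
      Fintype.sum_prod_type]
    dsimp only
    rw [← Finset.sum_mul_sum, hΦ, hΨ, ite_zero_mul_ite_zero, mul_one]
    refine if_congr ?_ rfl rfl
    rw [← Prod.ext_iff, (splitBits a c).injective.eq_iff]

theorem Gate.isChannel (g : Gate) : IsChannel g.channel := by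
  cases g with
  | unitary k U hU halg =>
    have h : ∀ i i' y y', (Gate.unitary k U hU halg).channel (Matrix.single i i' 1) y y' =
        U y i * star (U y' i') := fun i i' y y' => by
      simp [Gate.channel, Matrix.mul_apply, Matrix.single_apply, ite_and]
    refine ⟨⟨Unit, inferInstance, fun _ => U, fun i i' y y' => by rw [h]; simp⟩, fun i i' => ?_⟩
    have hU' := congrFun (congrFun (Matrix.mem_unitaryGroup_iff'.1 hU) i') i
    rw [Matrix.mul_apply, Matrix.one_apply] at hU'
    simp only [h]
    rw [if_congr eq_comm rfl rfl, ← hU']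
    exact Finset.sum_congr rfl fun y _ => by rw [Matrix.star_apply, mul_comm]
  | prep =>
    have h : ∀ i i' y y', Gate.prep.channel (Matrix.single i i' 1) y y' =
        (if (fun _ => false) = y then 1 else 0) * (if (fun _ => false) = y' then 1 else 0) := by
      intro i i' y y'
      obtain rfl : i = i' := Subsingleton.elim _ _
      simp [Gate.channel, ketbra, Matrix.single_apply, ite_and]
      split_ifs <;> rfl
    refine ⟨⟨Unit, inferInstance, fun _ y _ => if (fun _ => false) = y then 1 else 0,
      fun i i' y y' => ?_⟩, fun i i' => ?_⟩
    · rw [h]; simp [apply_ite (starRingEnd ℂ)]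
    · rw [if_pos (Subsingleton.elim _ _)]; simp [h]
  | trace =>
    have h : ∀ i i' y y', Gate.trace.channel (Matrix.single i i' 1) y y' =
        if i = i' then 1 else 0 := by
      intro i i' y y'
      obtain rfl : y = y' := Subsingleton.elim _ _
      simp only [Gate.channel, LinearMap.smulRight_apply, Matrix.traceLinearMap_apply,
        Matrix.smul_apply, Matrix.one_apply_eq, smul_eq_mul, mul_one]
      split_ifs with hi
      · subst hi; exact Matrix.trace_single_eq_same _ _
      · exact Matrix.trace_single_eq_of_ne _ _ _ hi
    refine ⟨⟨Bits 1, inferInstance, fun k _ i => if i = k then 1 else 0, fun i i' y y' => ?_⟩,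
      fun i i' => ?_⟩
    · rw [h]; simp [apply_ite (starRingEnd ℂ)]
    · simp only [h]
      rw [Fintype.sum_unique]

theorem Layer.isChannel {G : GateSet} (L : Layer G) : IsChannel (Layer.channel L) := by
  induction L with
  | nil => exact IsChannel.id 0
  | cons i L ih => exact (Gate.isChannel _).tensor ih

theorem Circuit.isChannel {G : GateSet} {a b : ℕ} (C : Circuit G a b) : IsChannel C.channel := by
  induction C with
  | nil a => exact IsChannel.id a
  | cons L C ih => exact (Layer.isChannel L).comp ih

/-- In Kraus form this diagonal entry is a sum of squared moduli, so taking the real part in `prob`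
loses nothing. -/
theorem Circuit.channel_apply_eq_prob {G : GateSet} {a b : ℕ} (C : Circuit G a b) (x : Bits a)
    (y : Bits b) : 0 ≤ C.prob x y ∧ C.channel (ketbra x) y y = (C.prob x y : ℂ) := by
  obtain ⟨⟨ι, _, K, hK⟩, -⟩ := C.isChannel
  have h : C.channel (ketbra x) y y = ((∑ k, Complex.normSq (K k y x) : ℝ) : ℂ) := by
    rw [ketbra, hK, Complex.ofReal_sum]
    exact Finset.sum_congr rfl fun k _ => Complex.mul_conj _
  have h' : C.prob x y = ∑ k, Complex.normSq (K k y x) := by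
    rw [Circuit.prob, h, Complex.ofReal_re]
  exact ⟨h' ▸ Finset.sum_nonneg fun _ _ => Complex.normSq_nonneg _, h.trans (by rw [h'])⟩

theorem Circuit.prob_nonneg {G : GateSet} {a b : ℕ} (C : Circuit G a b) (x : Bits a)
    (y : Bits b) : 0 ≤ C.prob x y := (C.channel_apply_eq_prob x y).1

theorem Circuit.sum_prob {G : GateSet} {a b : ℕ} (C : Circuit G a b) (x : Bits a) :
    ∑ y, C.prob x y = 1 := by
  have h := C.isChannel.2 x x
  rw [if_pos rfl] at h
  have : ((∑ y, C.prob x y : ℝ) : ℂ) = 1 := by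
    rw [Complex.ofReal_sum, ← h]
    exact Finset.sum_congr rfl fun y _ => (C.channel_apply_eq_prob x y).2.symm
  exact_mod_cast this

/-! ### Matrix elements on diagonal strings -/

/-- The list of pairs of equal bits. -/
def dbl {n : ℕ} (x : Bits n) : List (Bool × Bool) := List.ofFn fun i => (x i, x i)

@[simp] theorem length_dbl {n : ℕ} (x : Bits n) : (dbl x).length = n := by simp [dbl]

theorem fstBits_dbl {n : ℕ} (x : Bits n) : fstBits n (dbl x) = x := by
  funext i; simp [fstBits, dbl]

theorem sndBits_dbl {n : ℕ} (x : Bits n) : sndBits n (dbl x) = x := by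
  funext i; simp [sndBits, dbl]

theorem dbl_injective {n : ℕ} : Function.Injective (dbl : Bits n → _) := fun x y h => by
  rw [← fstBits_dbl x, h, fstBits_dbl]

theorem isDiag_dbl {n : ℕ} (x : Bits n) : IsDiag (dbl x) := by
  intro a ha
  obtain ⟨i, rfl⟩ := (List.mem_ofFn' _ _).1 ha
  rfl

theorem sum_diag {n : ℕ} (f : List (Bool × Bool) → ℂ) :
    ∑ A ∈ strs n, (if IsDiag A then f A else 0) = ∑ x : Bits n, f (dbl x) := by
  rw [← Finset.sum_filter]
  refine (Finset.sum_bij (fun x _ => dbl x) ?_ ?_ ?_ ?_).symm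
  · intro x _; simp [isDiag_dbl]
  · intro x _ y _ h; exact dbl_injective h
  · intro A hA
    simp only [Finset.mem_filter, mem_strs] at hA
    obtain ⟨hA, hd⟩ := hA
    refine ⟨fstBits n A, Finset.mem_univ _, ?_⟩
    rw [← bits_ext (length_dbl _) hA, fstBits_dbl, sndBits_dbl]
    refine ⟨rfl, funext fun i => ?_⟩
    have hi : (i : ℕ) < A.length := hA ▸ i.2
    simp only [fstBits, sndBits, List.getD_eq_getElem _ _ hi]
    exact hd _ (List.getElem_mem hi)
  · intro x _; rfl

theorem Circuit.layersKer_dbl {G : GateSet} {a b : ℕ} (C : Circuit G a b) (x : Bits a)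
    (y : Bits b) : layersKer C.layers (dbl x) (dbl y) = (C.prob x y : ℂ) := by
  rw [← (C.channel_apply_eq_prob x y).2, ← C.ker_channel (length_dbl x) (length_dbl y), ker,
    fstBits_dbl, fstBits_dbl, sndBits_dbl, sndBits_dbl]
  rfl

/-! ### One round of the sampling circuit -/

variable {G : GateSet}

theorem zipWith_select_true {X A : List (Bool × Bool)} (h : X.length = A.length) :
    List.zipWith (select (true, true)) X A = A := by
  induction X generalizing A with
  | nil => rw [List.length_eq_zero_iff.1 h.symm]; rfl
  | cons x X ih =>
    obtain ⟨a, A, rfl⟩ := List.exists_cons_of_length_eq_add_one h.symm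
    rw [List.zipWith_cons_cons, ih (by simpa using h)]
    rfl

theorem zipWith_select_false {X A : List (Bool × Bool)} (h : X.length = A.length) :
    List.zipWith (select (false, false)) X A = X := by
  induction X generalizing A with
  | nil => simp
  | cons x X ih =>
    obtain ⟨a, A, rfl⟩ := List.exists_cons_of_length_eq_add_one h.symm
    rw [List.zipWith_cons_cons, ih (by simpa using h)]
    rfl

theorem inputs_rep (m : ℕ) (L : Layer G) :
    Layer.inputs (rep m L : Layer G) = m * Layer.inputs L := by
  induction m with
  | zero => simp [Layer.inputs]
  | succ m ih => rw [rep_succ, inputs_append, ih]; ring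

theorem outputs_rep (m : ℕ) (L : Layer G) :
    Layer.outputs (rep m L : Layer G) = m * Layer.outputs L := by
  induction m with
  | zero => simp [Layer.outputs]
  | succ m ih => rw [rep_succ, outputs_append, ih]; ring

theorem inputs_cons (i : Fin G.length) (L : Layer G) :
    Layer.inputs (i :: L : Layer G) = Layer.inputs ([i] : Layer G) + Layer.inputs L := rfl

theorem outputs_cons (i : Fin G.length) (L : Layer G) :
    Layer.outputs (i :: L : Layer G) = Layer.outputs ([i] : Layer G) + Layer.outputs L := rfl

theorem outputs_discardLayer (m : ℕ) : Layer.outputs (discardLayer G m) = m := by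
  simp only [discardLayer, outputs_append, outputs_rep]
  rw [outputs_cons, outputs_newIx, outputs_newIx]
  simp

theorem layersKer_singleton (L : Layer G) (x : List (Bool × Bool)) {y : List (Bool × Bool)}
    (hy : y.length = Layer.outputs L) : layersKer [L] x y = layerKer L x y := by
  simp only [layersKer, mul_ite, mul_one, mul_zero]
  rw [Finset.sum_ite_eq', if_pos (mem_strs.2 hy)]

theorem outputs_bellLayer (m : ℕ) : Layer.outputs (bellLayer G m) = 3 * m := by
  simp only [bellLayer, outputs_rep]
  rw [outputs_cons, outputs_newIx, outputs_newIx]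
  simp; ring

theorem length_triples {α : Type*} {n : ℕ} {X A B : List α} (hX : X.length = n)
    (hA : A.length = n) (hB : B.length = n) : (triples X A B).length = 3 * n := by
  induction X generalizing A B n with
  | nil => subst hX; simp [triples]
  | cons x X ih =>
    subst hX
    obtain ⟨a, A, rfl⟩ := List.exists_cons_of_length_eq_add_one hA
    obtain ⟨b, B, rfl⟩ := List.exists_cons_of_length_eq_add_one hB
    simp only [triples, List.length_cons] at hA hB ⊢
    rw [ih rfl (by omega) (by omega)]
    omega

/-- The two terms are the outcomes of the test on the drawn string `A`. On acceptance `A` becomes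
the new string `S` and the old `X` is traced out; on rejection `X` is kept and `A` is traced out.
Coherences between the outcomes vanish because the control qubit is traced out. -/
theorem layersKer_roundLayers {m : ℕ} {Ls : List (Layer G)} (h : Composable m Ls 1)
    {X S : List (Bool × Bool)} (hX : X.length = m) (hS : S.length = m) :
    layersKer (roundLayers m Ls) X S = (1 / 2) ^ m *
      ((if IsDiag X then layersKer Ls S [(true, true)] else 0) +
        (if S = X then ∑ A ∈ strs m, (if IsDiag A then layersKer Ls A [(false, false)] else 0)
          else 0)) := by
  have hr : ∀ A ∈ strs m, layersKer (rotLayers G 0 m ++ (copyLayers m Ls ++ (selLayers G 0 m ++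
      [discardLayer G m]))) (triples X A A) S =
      (if IsDiag X then if A = S then layersKer Ls S [(true, true)] else 0 else 0) +
        (if S = X then if IsDiag A then layersKer Ls A [(false, false)] else 0 else 0) := by
    intro A hA
    rw [mem_strs] at hA
    have h₁ := layersKer_rotLayers G (k := 0) (P := []) (S := []) rfl hX hA hA rfl
      (copyLayers m Ls ++ (selLayers G 0 m ++ [discardLayer G m])) S
    rw [List.nil_append, List.append_nil, List.nil_append, List.append_nil] at h₁
    rw [h₁, layersKer_copyLayers h hA (length_pairs hX hA), sum_strs_one]
    have h₂ : ∀ c : Bool × Bool, layersKer (selLayers G 0 m ++ [discardLayer G m])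
        ([c] ++ pairs X A) S = if S = List.zipWith (select c) X A ∧
          IsDiag (List.zipWith (select c) A X) ∧ c.1 = c.2 then 1 else 0 := by
      intro c
      have h₃ := layersKer_selLayers G (k := 0) (P := []) rfl hX hA c [discardLayer G m] S
      rw [List.nil_append, List.nil_append] at h₃
      rw [List.singleton_append, h₃, layersKer_singleton _ _ (by rw [hS, outputs_discardLayer]),
        layerKer_discardLayer G (by simp [hX, hA]) (by simp [hX, hA]) hS]
    have hXA := hX.trans hA.symm
    -- Of the four values of the control entry `c` only `(true, true)` and `(false, false)` survive
    -- the trace.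
    simp only [h₂, Fintype.sum_prod_type, Fintype.sum_bool, zipWith_select_true hXA,
      zipWith_select_false hXA, zipWith_select_true hXA.symm, zipWith_select_false hXA.symm]
    simp only [and_true, reduceCtorEq, and_false, if_false, mul_zero, add_zero, zero_add, mul_ite,
      mul_one, ite_and]
    congr 1
    by_cases hAS : A = S
    · subst hAS; simp
    · simp [hAS, Ne.symm hAS]
  rw [roundLayers, List.cons_append, (det_prepLayer G hX).layersKer_cons, List.cons_append,
    List.nil_append, layersKer, outputs_bellLayer]
  have : ∀ z ∈ strs (3 * m), layerKer (bellLayer G m) (triples X (List.replicate m (false, false))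
      (List.replicate m (false, false))) z * layersKer (rotLayers G 0 m ++ (copyLayers m Ls ++
        (selLayers G 0 m ++ [discardLayer G m]))) z S = ∑ A ∈ strs m, if z = triples X A A then
      (1 / 2) ^ m * layersKer (rotLayers G 0 m ++ (copyLayers m Ls ++ (selLayers G 0 m ++
        [discardLayer G m]))) z S else 0 := by
    intro z hz
    rw [layerKer_bellLayer G hX (mem_strs.1 hz), Finset.sum_mul]
    simp only [ite_mul, zero_mul]
  rw [Finset.sum_congr rfl this, Finset.sum_comm]
  have : ∀ A ∈ strs m, (∑ z ∈ strs (3 * m), if z = triples X A A then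
      (1 / 2) ^ m * layersKer (rotLayers G 0 m ++ (copyLayers m Ls ++ (selLayers G 0 m ++
        [discardLayer G m]))) z S else 0) = (1 / 2) ^ m *
      ((if IsDiag X then if A = S then layersKer Ls S [(true, true)] else 0 else 0) +
        (if S = X then if IsDiag A then layersKer Ls A [(false, false)] else 0 else 0)) := by
    intro A hA
    rw [Finset.sum_ite_eq', if_pos (mem_strs.2 (length_triples hX (mem_strs.1 hA) (mem_strs.1 hA))),
      hr A hA]
  rw [Finset.sum_congr rfl this, ← Finset.mul_sum, Finset.sum_add_distrib]
  congr 2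
  · split_ifs
    · rw [Finset.sum_ite_eq', if_pos (mem_strs.2 hS)]
    · simp
  · split_ifs
    · rfl
    · simp

/-! ### The sampling circuit -/

/-! ### Matching of qubit counts -/

section composable

variable (G : GateSet)

theorem inputs_rotLayer (k j : ℕ) : Layer.inputs (rotLayer G k j) = 3 * (k + j) := by
  simp only [rotLayer, inputs_append, inputs_rep]
  rw [inputs_cons (newIx G 0) [newIx G 0], inputs_newIx, inputs_newIx]
  simp; ring

theorem outputs_rotLayer (k j : ℕ) : Layer.outputs (rotLayer G k j) = 3 * (k + j) := by
  simp only [rotLayer, outputs_append, outputs_rep]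
  rw [outputs_cons (newIx G 0) [newIx G 0], outputs_newIx, outputs_newIx]
  simp; ring

theorem inputs_selLayer (k j : ℕ) : Layer.inputs (selLayer G k j) = 1 + 2 * (k + (j + 1)) := by
  simp only [selLayer, inputs_append, inputs_rep]
  rw [inputs_cons (newIx G 0) [newIx G 0], inputs_newIx, inputs_newIx]
  simp; ring

theorem outputs_selLayer (k j : ℕ) : Layer.outputs (selLayer G k j) = 1 + 2 * (k + (j + 1)) := by
  simp only [selLayer, outputs_append, outputs_rep]
  rw [outputs_cons (newIx G 0) [newIx G 0], outputs_newIx, outputs_newIx]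
  simp; ring

theorem Composable.cons_of_eq {G : GateSet} {a b c : ℕ} {L : Layer G} {Ls : List (Layer G)}
    (ha : Layer.inputs L = a) (hb : Layer.outputs L = b) (h : Composable b Ls c) :
    Composable a (L :: Ls) c := by
  subst ha hb
  exact .cons L h

theorem composable_rotLayers {m : ℕ} (k j : ℕ) (h : k + j = m) :
    Composable (3 * m) (rotLayers G k j) (3 * m) := by
  induction j generalizing k with
  | zero => exact .nil _
  | succ j ih =>
    exact .cons_of_eq (by rw [inputs_rotLayer, h]) (by rw [outputs_rotLayer, h])
      (ih (k + 1) (by omega))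

theorem composable_selLayers {m : ℕ} (k j : ℕ) (h : k + j = m) :
    Composable (1 + 2 * m) (selLayers G k j) (1 + 2 * m) := by
  induction j generalizing k with
  | zero => exact .nil _
  | succ j ih =>
    exact .cons_of_eq (by rw [inputs_selLayer, h]) (by rw [outputs_selLayer, h])
      (ih (k + 1) (by omega))

variable {G}

theorem composable_copyLayers {a b : ℕ} (m : ℕ) {Ls : List (Layer G)} (h : Composable a Ls b) :
    Composable (a + 2 * m) (copyLayers m Ls) (b + 2 * m) := by
  have h₁ : Layer.inputs (rep m [newIx G 0, newIx G 0] : Layer (extGates G)) = 2 * m := by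
    rw [inputs_rep, inputs_cons, inputs_newIx]; simp; ring
  have h₂ : Layer.outputs (rep m [newIx G 0, newIx G 0] : Layer (extGates G)) = 2 * m := by
    rw [outputs_rep, outputs_cons, outputs_newIx]; simp; ring
  induction h with
  | nil a => exact .nil _
  | cons L h ih =>
    exact .cons_of_eq (by rw [inputs_append, inputs_map_oldIx, h₁])
      (by rw [outputs_append, outputs_map_oldIx, h₂]) ih

theorem composable_roundLayers {m : ℕ} {Ls : List (Layer G)} (h : Composable m Ls 1) :
    Composable m (roundLayers m Ls) m := by
  have h₁ : Layer.inputs (prepLayer G m) = m := by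
    rw [prepLayer, inputs_rep, inputs_cons, inputs_cons _ [newIx G 1], inputs_newIx, inputs_newIx]
    simp
  have h₂ : Layer.outputs (prepLayer G m) = 3 * m := by
    rw [prepLayer, outputs_rep, outputs_cons, outputs_cons _ [newIx G 1], outputs_newIx,
      outputs_newIx]
    simp; ring
  have h₃ : Layer.inputs (bellLayer G m) = 3 * m := by
    rw [bellLayer, inputs_rep, inputs_cons, inputs_newIx, inputs_newIx]
    simp; ring
  have h₄ : Layer.inputs (discardLayer G m) = 1 + 2 * m := by
    rw [discardLayer, inputs_append, inputs_rep, inputs_cons, inputs_newIx, inputs_newIx]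
    simp; ring
  have h₅ := composable_copyLayers m h
  rw [show m + 2 * m = 3 * m by ring] at h₅
  exact .cons_of_eq h₁ h₂ (.cons_of_eq h₃ (outputs_bellLayer m)
    ((composable_rotLayers G 0 m (zero_add m)).append (h₅.append
      ((composable_selLayers G 0 m (zero_add m)).append
        (.single _ h₄ (outputs_discardLayer m))))))

theorem composable_rep {a : ℕ} {Ls : List (Layer G)} (h : Composable a Ls a) (t : ℕ) :
    Composable a (rep t Ls) a := by
  induction t with
  | zero => exact .nil a
  | succ t ih => rw [rep_succ]; exact h.append ih

theorem composable_sampleLayers {m : ℕ} {Ls : List (Layer G)} (h : Composable m Ls 1) :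
    Composable 0 (sampleLayers m Ls) m := by
  refine .cons_of_eq ?_ ?_ (composable_rep (composable_roundLayers h) _)
  · rw [inputs_rep, inputs_newIx]; simp
  · rw [outputs_rep, outputs_newIx]; simp

end composable

/-! ### The law of the held string and the rejection sampling estimate -/

section probability

variable {G : GateSet} {m : ℕ}

theorem dbl_bits_one (b : Bool) : dbl (fun _ : Fin 1 => b) = [(b, b)] := by simp [dbl]

theorem acceptProb_nonneg (C : Circuit G m 1) (x : Bits m) : 0 ≤ acceptProb C x := C.prob_nonneg _ _

theorem prob_false_eq (C : Circuit G m 1) (x : Bits m) :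
    C.prob x (fun _ => false) = 1 - acceptProb C x := by
  have h := C.sum_prob x
  rw [Fintype.sum_equiv (Equiv.funUnique (Fin 1) Bool) _ (fun b => C.prob x fun _ => b)
    (fun y => by congr 1; funext i; fin_cases i; rfl), Fintype.sum_bool] at h
  rw [acceptProb]
  linarith

theorem acceptProb_le_one (C : Circuit G m 1) (x : Bits m) : acceptProb C x ≤ 1 := by
  have h := C.prob_nonneg x fun _ => false
  rw [prob_false_eq] at h
  linarith

theorem sum_acceptProb (C : Circuit G m 1) :
    ∑ x, acceptProb C x = 2 ^ m * avgAcceptProb C := by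
  rw [avgAcceptProb, Fintype.expect_eq_sum_div_card]
  simp only [Fintype.card_pi, Fintype.card_bool, Finset.prod_const, Finset.card_univ,
    Fintype.card_fin, Nat.cast_pow, Nat.cast_ofNat]
  field_simp

theorem avgAcceptProb_nonneg (C : Circuit G m 1) : 0 ≤ avgAcceptProb C :=
  Finset.expect_nonneg fun x _ => acceptProb_nonneg C x

theorem avgAcceptProb_le_one (C : Circuit G m 1) : avgAcceptProb C ≤ 1 :=
  Finset.expect_le Finset.univ_nonempty fun x _ => acceptProb_le_one C x

/-- The probability that the sampling circuit for `C` holds the string `s` after `t` rounds. -/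
def roundProb (C : Circuit G m 1) : ℕ → Bits m → ℝ
  | 0, s => if (fun _ => false) = s then 1 else 0
  | t + 1, s => ((2 : ℝ) ^ m)⁻¹ * acceptProb C s + (1 - avgAcceptProb C) * roundProb C t s

theorem sum_roundProb (C : Circuit G m 1) (t : ℕ) : ∑ s, roundProb C t s = 1 := by
  induction t with
  | zero => simp [roundProb]
  | succ t ih =>
    simp only [roundProb, Finset.sum_add_distrib, ← Finset.mul_sum, ih, sum_acceptProb]
    field_simp
    ring

/-- Unrolled, the recursion is a geometric sum plus the contribution of the initial string, which is
nonnegative and dropped. -/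
theorem le_roundProb (C : Circuit G m 1) (t : ℕ) (s : Bits m) :
    ((2 : ℝ) ^ m)⁻¹ * acceptProb C s * ∑ j ∈ Finset.range t, (1 - avgAcceptProb C) ^ j ≤
      roundProb C t s := by
  have h : 0 ≤ 1 - avgAcceptProb C := sub_nonneg.2 (avgAcceptProb_le_one C)
  induction t with
  | zero => simp only [roundProb, Finset.range_zero, Finset.sum_empty, mul_zero]; positivity
  | succ t ih =>
    rw [roundProb, Finset.sum_range_succ', pow_zero, mul_add, mul_one, add_comm]
    refine add_le_add le_rfl ?_
    simp only [pow_succ', ← Finset.mul_sum]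
    calc _ = (1 - avgAcceptProb C) * (((2 : ℝ) ^ m)⁻¹ * acceptProb C s *
          ∑ j ∈ Finset.range t, (1 - avgAcceptProb C) ^ j) := by ring
      _ ≤ _ := mul_le_mul_of_nonneg_left ih h

/-- In `layersKer_roundLayers` the acceptance term sees only the diagonal of the current state,
whose total mass is one, and the rejection term only its entry at `s`. This gives the recursion for
`roundProb`, although the sum over intermediate indices includes off-diagonal ones. -/
theorem layersKer_rep_roundLayers (C : Circuit G m 1) (t : ℕ) (s : Bits m) :
    layersKer (rep t (roundLayers m C.layers)) (dbl fun _ : Fin m => false) (dbl s) =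
      (roundProb C t s : ℂ) := by
  induction t generalizing s with
  | zero =>
    simp only [rep_zero, layersKer, roundProb, dbl_injective.eq_iff]
    split_ifs <;> simp
  | succ t ih =>
    -- The last round is split off, to match the recursion of `roundProb`.
    rw [rep_succ, ← rep_comm, layersKer_append (composable_rep (composable_roundLayers C.composable) t)
      _ (length_dbl _)]
    have h : ∀ z ∈ strs m, layersKer (rep t (roundLayers m C.layers)) (dbl fun _ : Fin m => false) z *
        layersKer (roundLayers m C.layers) z (dbl s) = (1 / 2) ^ m *
        ((acceptProb C s : ℂ) * (if IsDiag z then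
          layersKer (rep t (roundLayers m C.layers)) (dbl fun _ : Fin m => false) z else 0) +
        (if dbl s = z then layersKer (rep t (roundLayers m C.layers)) (dbl fun _ : Fin m => false) z *
          ((2 ^ m * (1 - avgAcceptProb C) : ℝ) : ℂ) else 0)) := by
      intro z hz
      have h₁ : ∑ A ∈ strs m, (if IsDiag A then layersKer C.layers A [(false, false)] else 0) =
          ((2 ^ m * (1 - avgAcceptProb C) : ℝ) : ℂ) := by
        rw [sum_diag]
        simp only [← dbl_bits_one, C.layersKer_dbl, prob_false_eq]
        rw [← Complex.ofReal_sum, Finset.sum_sub_distrib, sum_acceptProb]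
        simp [mul_sub]
      rw [layersKer_roundLayers C.composable (mem_strs.1 hz) (length_dbl s), h₁,
        ← dbl_bits_one true, C.layersKer_dbl, ← acceptProb]
      split_ifs <;> ring
    rw [Finset.sum_congr rfl h, ← Finset.mul_sum, Finset.sum_add_distrib, ← Finset.mul_sum,
      sum_diag, Finset.sum_ite_eq, if_pos (mem_strs.2 (length_dbl s))]
    simp only [ih]
    rw [← Complex.ofReal_sum, sum_roundProb, roundProb, one_div, inv_pow]
    push_cast
    field_simp

theorem prob_of_layers_eq_sampleLayers (C : Circuit G m 1) (D : Circuit (extGates G) 0 m)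
    (hD : D.layers = sampleLayers m C.layers) (s : Bits m) :
    D.prob Fin.elim0 s = roundProb C (2 ^ m) s := by
  have h := D.layersKer_dbl Fin.elim0 s
  have hd : Det (rep m [newIx G 1]) [] (dbl fun _ : Fin m => false) := by
    have : (dbl fun _ : Fin m => false) = List.replicate m (false, false) := by
      simp [dbl, List.ofFn_const]
    rw [this]
    -- The circuits and `s` depend on `m` and would obstruct the induction.
    clear * -
    induction m with
    | zero => exact Det.nil
    | succ m ih => rw [rep_succ]; exact (det_prep G).append ih
  have h₀ : dbl (Fin.elim0 : Bits 0) = [] := rfl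
  rw [hD, sampleLayers, h₀, hd.layersKer_cons, layersKer_rep_roundLayers] at h
  exact_mod_cast h.symm

/-- The sum times `a` telescopes to `1 - (1 - a) ^ T`, and the sum divided by `T` is at least `(1 -
a) ^ T`, since no term is smaller. Adding the two avoids a case distinction on the size of `a`. -/
theorem one_le_geom_sum_mul {a : ℝ} (ha : 0 ≤ a) (ha' : a ≤ 1) {T : ℕ} (hT : 0 < T) :
    1 ≤ (∑ j ∈ Finset.range T, (1 - a) ^ j) * ((T : ℝ)⁻¹ + a) := by
  have h₁ : (∑ j ∈ Finset.range T, (1 - a) ^ j) * a = 1 - (1 - a) ^ T := by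
    have := geom_sum_mul_neg (1 - a) T
    rwa [sub_sub_cancel] at this
  have h₂ : (T : ℝ) * (1 - a) ^ T ≤ ∑ j ∈ Finset.range T, (1 - a) ^ j := by
    have := Finset.card_nsmul_le_sum (Finset.range T) (fun j => (1 - a) ^ j) ((1 - a) ^ T)
      fun j hj => pow_le_pow_of_le_one (by linarith) (by linarith) (Finset.mem_range.1 hj).le
    simpa using this
  have hT' : (0 : ℝ) < T := by exact_mod_cast hT
  have h₃ : (1 - a) ^ T ≤ (∑ j ∈ Finset.range T, (1 - a) ^ j) * (T : ℝ)⁻¹ := by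
    rw [← div_eq_mul_inv, le_div_iff₀ hT']
    linarith
  rw [mul_add, h₁]
  linarith

theorem acceptProb_le_of_prob_lt (C : Circuit G m 1) (D : Circuit (extGates G) 0 m)
    (hD : D.layers = sampleLayers m C.layers) (s : Bits m) {q : ℝ}
    (h : D.prob Fin.elim0 s < q * ((2 : ℝ) ^ m)⁻¹) :
    acceptProb C s ≤ q * (((2 : ℝ) ^ m)⁻¹ + avgAcceptProb C) := by
  rw [prob_of_layers_eq_sampleLayers C D hD] at h
  have h₁ := (le_roundProb C (2 ^ m) s).trans h.le
  have h₂ := one_le_geom_sum_mul (avgAcceptProb_nonneg C) (avgAcceptProb_le_one C)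
    -- This number of rounds makes `T⁻¹` the summand `2^{-m}` of the claim.
    (T := 2 ^ m) (by positivity)
  push_cast at h₂
  set S := ∑ j ∈ Finset.range (2 ^ m), (1 - avgAcceptProb C) ^ j
  have hpos : (0 : ℝ) < ((2 : ℝ) ^ m)⁻¹ := by positivity
  have h₃ : acceptProb C s * S ≤ q := by
    refine le_of_mul_le_mul_right ?_ hpos
    calc _ = ((2 : ℝ) ^ m)⁻¹ * acceptProb C s * S := by ring
      _ ≤ _ := h₁
  have h₄ : 0 ≤ ((2 : ℝ) ^ m)⁻¹ + avgAcceptProb C := add_nonneg hpos.le (avgAcceptProb_nonneg C)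
  calc acceptProb C s ≤ acceptProb C s * (S * (((2 : ℝ) ^ m)⁻¹ + avgAcceptProb C)) :=
        le_mul_of_one_le_right (acceptProb_nonneg C s) h₂
    _ = acceptProb C s * S * (((2 : ℝ) ^ m)⁻¹ + avgAcceptProb C) := by ring
    _ ≤ _ := mul_le_mul_of_nonneg_right h₃ h₄

end probability

/-! ### The description of the sampling circuit -/

section code

variable {G : GateSet}

/-- The descriptions of the auxiliary gates. -/
def auxWords (G : GateSet) : GateWords :=
  let w (j : ℕ) := GateWords.gateCode (G.length + j)
  ⟨w 0, w 1, w 2, w 3, w 4, w 5⟩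

/-- The numbers of the gates in a list of layers. -/
def gateNumbers (Ls : List (Layer G)) : List (List ℕ) := Ls.map fun L => L.map Fin.val

theorem layerCode_eq (L : Layer G) :
    Circuit.layerCode L = L.flatMap (fun i : Fin G.length => GateWords.gateCode i.val) ++ [false] := rfl

theorem newIx_val (j : Fin 6) : (newIx G j).val = G.length + j := rfl

theorem oldIx_val (i : Fin G.length) : (oldIx G i).val = i := rfl

theorem flatMap_rep {α β : Type*} (f : α → List β) (m : ℕ) (w : List α) :
    (rep m w).flatMap f = rep m (w.flatMap f) := by
  induction m with
  | zero => rfl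
  | succ m ih => rw [rep_succ, rep_succ, List.flatMap_append, ih]

theorem flatMap_layerCode (Ls : List (Layer G)) :
    Ls.flatMap Circuit.layerCode = GateWords.layersWord [] (gateNumbers Ls) := by
  simp only [GateWords.layersWord, gateNumbers, List.flatMap_map, List.append_nil]
  rfl

theorem flatMap_rotLayers (k j : ℕ) :
    (rotLayers G k j).flatMap Circuit.layerCode = (auxWords G).rotWord k j := by
  induction j generalizing k with
  | zero => rfl
  | succ j ih =>
    rw [rotLayers, GateWords.rotWord, List.flatMap_cons, ih, layerCode_eq, rotLayer]
    simp [flatMap_rep, auxWords, newIx_val]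

theorem flatMap_selLayers (k j : ℕ) :
    (selLayers G k j).flatMap Circuit.layerCode = (auxWords G).selWord k j := by
  induction j generalizing k with
  | zero => rfl
  | succ j ih =>
    rw [selLayers, GateWords.selWord, List.flatMap_cons, ih, layerCode_eq, selLayer]
    simp [flatMap_rep, auxWords, newIx_val]

theorem flatMap_copyLayers (m : ℕ) (Ls : List (Layer G)) :
    (copyLayers m Ls).flatMap Circuit.layerCode =
      GateWords.layersWord (rep m ((auxWords G).idw ++ (auxWords G).idw)) (gateNumbers Ls) := by
  simp only [copyLayers, GateWords.layersWord, gateNumbers, List.flatMap_map, layerCode_eq,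
    List.flatMap_append, flatMap_rep]
  simp [auxWords, newIx_val, oldIx_val]

theorem flatMap_sampleLayers (m : ℕ) (Ls : List (Layer G)) :
    [false] ++ (sampleLayers m Ls).flatMap Circuit.layerCode =
      (auxWords G).sampleWord m (gateNumbers Ls) := by
  have h : (roundLayers m Ls).flatMap Circuit.layerCode =
      (auxWords G).roundWord m (gateNumbers Ls) := by
    rw [roundLayers, GateWords.roundWord]
    simp only [List.flatMap_append, flatMap_rotLayers, flatMap_copyLayers, flatMap_selLayers,
      List.flatMap_cons, List.flatMap_nil, layerCode_eq, prepLayer, bellLayer, discardLayer,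
      flatMap_rep, List.append_nil, List.append_assoc]
    simp [auxWords, newIx_val]
  rw [sampleLayers, List.flatMap_cons, flatMap_rep, h, layerCode_eq, flatMap_rep,
    GateWords.sampleWord]
  simp [auxWords, newIx_val]

end code

/-! ### Functions bounded by an exponential -/

/-- Functions bounded by `2 ^ p(n)` for a polynomial `p`. -/
def ExpBounded (f : ℕ → ℕ) : Prop := ∃ p : Polynomial ℕ, ∀ n, f n ≤ 2 ^ p.eval n

namespace ExpBounded

variable {f g : ℕ → ℕ}

theorem mono (hg : ExpBounded g) (h : ∀ n, f n ≤ g n) : ExpBounded f :=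
  hg.imp fun _ hp n => (h n).trans (hp n)

theorem const (c : ℕ) : ExpBounded fun _ => c :=
  ⟨Polynomial.C c, fun n => by simpa using Nat.lt_two_pow_self.le⟩

theorem natCast : ExpBounded fun n => n :=
  ⟨Polynomial.X, fun n => by simpa using Nat.lt_two_pow_self.le⟩

theorem mul (hf : ExpBounded f) (hg : ExpBounded g) : ExpBounded fun n => f n * g n := by
  obtain ⟨p, hp⟩ := hf
  obtain ⟨q, hq⟩ := hg
  exact ⟨p + q, fun n => by rw [Polynomial.eval_add, pow_add]; exact Nat.mul_le_mul (hp n) (hq n)⟩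

theorem add (hf : ExpBounded f) (hg : ExpBounded g) : ExpBounded fun n => f n + g n := by
  obtain ⟨p, hp⟩ := hf
  obtain ⟨q, hq⟩ := hg
  refine ⟨p + q + 1, fun n => ?_⟩
  rw [Polynomial.eval_add, Polynomial.eval_add, Polynomial.eval_one, pow_succ, mul_two]
  exact add_le_add ((hp n).trans (Nat.pow_le_pow_right two_pos (by omega)))
    ((hq n).trans (Nat.pow_le_pow_right two_pos (by omega)))

theorem two_pow {k : ℕ}
    (h : (fun n : ℕ => (f n : ℝ)) =O[Filter.atTop] fun n : ℕ => (n : ℝ) ^ k) :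
    ExpBounded fun n => 2 ^ f n := by
  obtain ⟨c, hc⟩ := h.bound
  obtain ⟨N, hN⟩ := Filter.eventually_atTop.1 hc
  refine ⟨Polynomial.C ⌈c⌉₊ * Polynomial.X ^ k + Polynomial.C (∑ i ∈ Finset.range N, f i),
    fun n => Nat.pow_le_pow_right two_pos ?_⟩
  simp only [Polynomial.eval_add, Polynomial.eval_mul, Polynomial.eval_C, Polynomial.eval_pow,
    Polynomial.eval_X]
  rcases lt_or_ge n N with hn | hn
  · exact le_add_left (Finset.single_le_sum (fun i _ => Nat.zero_le (f i)) (Finset.mem_range.2 hn))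
  · refine le_add_right ?_
    have h₁ := hN n hn
    rw [Real.norm_natCast, norm_pow, Real.norm_natCast] at h₁
    have h₂ : (f n : ℝ) ≤ ⌈c⌉₊ * (n : ℝ) ^ k :=
      h₁.trans (mul_le_mul_of_nonneg_right (Nat.le_ceil c) (by positivity))
    exact_mod_cast h₂

end ExpBounded

/-! ### The family of sampling circuits -/

section family

variable {G : GateSet} {ℓ : ℕ → ℕ} {C : ∀ n, Circuit G (ℓ n) 1}
  {D : ∀ n, Circuit (extGates G) 0 (ℓ n)}

theorem exists_sampleCircuit (C : ∀ n, Circuit G (ℓ n) 1) :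
    ∃ D : ∀ n, Circuit (extGates G) 0 (ℓ n),
      ∀ n, (D n).layers = sampleLayers (ℓ n) (C n).layers := by
  choose D hD using fun n => (composable_sampleLayers (C n).composable).exists_circuit
  exact ⟨D, hD⟩

/-- The auxiliary gates are listed after those of `G`, so gate numbers persist and the codes of the
given gates are copied verbatim. -/
theorem runs_sampleProg_code {m : ℕ} (C : Circuit G m 1) (D : Circuit (extGates G) 0 m)
    (hD : D.layers = sampleLayers m C.layers) :
    (auxWords G).sampleProg.Runs (Function.update (fun _ => []) .t C.code.reverse)
      (Function.update (fun _ => []) .i D.code) ((auxWords G).sampleTime C.code.length m) := by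
  have h₁ : C.code = List.replicate m true ++ [false] ++
      GateWords.layersWord [] (gateNumbers C.layers) := by
    rw [Circuit.code, flatMap_layerCode]
  have h₂ : D.code = (auxWords G).sampleWord m (gateNumbers C.layers) := by
    rw [← flatMap_sampleLayers, Circuit.code, hD]
    rfl
  rw [h₁, h₂]
  exact (auxWords G).runs_sampleProg m (gateNumbers C.layers) _ rfl

theorem IsUniform.sample (hC : IsUniform C) (hD : ∀ n, (D n).layers = sampleLayers (ℓ n) (C n).layers) :
    IsUniform D := by
  obtain ⟨M⟩ := hC
  refine tm2Computable_of_exec M (auxWords G).sampleProg .t .i fun n => ?_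
  obtain ⟨t, -, ht⟩ := runs_sampleProg_code (C n) (D n) (hD n)
  exact ⟨t, ht⟩

theorem length_unaryEncodeNat (n : ℕ) : (Computability.unaryEncodeNat n).length = n := by
  induction n with
  | zero => rfl
  | succ n ih => simp [Computability.unaryEncodeNat, ih]

/-- Exponentially bounded functions are closed under sums and products; the two inputs are the
length of the description, bounded through the time of the given machine, and `2 ^ ℓ n`, bounded
through `hℓ`. -/
theorem IsExpTime.sample (hC : IsExpTime C) {k : ℕ}
    (hℓ : (fun n : ℕ => (ℓ n : ℝ)) =O[Filter.atTop] fun n : ℕ => (n : ℝ) ^ k)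
    (hD : ∀ n, (D n).layers = sampleLayers (ℓ n) (C n).layers) : IsExpTime D := by
  obtain ⟨M, hM⟩ := hC
  change ExpBounded M.time at hM
  have hlen : ExpBounded fun n => (C n).code.length := by
    obtain ⟨c, hc⟩ := exists_length_le_time M
    refine (ExpBounded.natCast.add ((ExpBounded.const c).mul hM)).mono fun n => ?_
    simpa [length_unaryEncodeNat] using hc n
  have h2 : ExpBounded fun n => 2 ^ ℓ n := .two_pow hℓ
  have hm : ExpBounded ℓ := h2.mono fun n => Nat.lt_two_pow_self.le
  have hround : ExpBounded fun n => GateWords.roundTime (C n).code.length := by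
    simp only [GateWords.roundTime, pow_two]
    exact (ExpBounded.const _).mul ((hlen.add (.const _)).mul (hlen.add (.const _)))
  have hword : ExpBounded fun n => 2 ^ ℓ n *
      ((auxWords G).roundProg.width * GateWords.roundTime (C n).code.length) :=
    h2.mul ((ExpBounded.const _).mul hround)
  have hsample : ExpBounded fun n => (auxWords G).sampleTime (C n).code.length (ℓ n) :=
    hround.add (((hm.mul (((ExpBounded.const 9).mul hword).add (.const 6))).add (.const 1)).add
      ((((ExpBounded.const 2).mul hword).add ((ExpBounded.const 2).mul hm)).add (.const 4)))
  obtain ⟨M', hM'⟩ := tm2ComputableInTime_of_exec M (auxWords G).sampleProg .t .i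
    (fun n => (auxWords G).sampleTime (C n).code.length (ℓ n))
    (fun n => runs_sampleProg_code (C n) (D n) (hD n))
    (fun n => M.time n + ((C n).code.length + 1) +
      (auxWords G).sampleTime (C n).code.length (ℓ n) + 1)
    (fun n => by rw [length_unaryEncodeNat])
  refine ⟨M', ?_⟩
  rw [hM']
  exact ((hM.add (hlen.add (.const 1))).add hsample).add (.const 1)

end family

/-! ### Negligible functions -/

theorem eventually_inv_two_pow_le {ℓ : ℕ → ℕ}
    (h : (fun n : ℕ => Real.logb 2 (n : ℝ)) =o[Filter.atTop] fun n : ℕ => (ℓ n : ℝ)) (c : ℕ) :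
    ∀ᶠ n : ℕ in Filter.atTop, ((2 : ℝ) ^ ℓ n)⁻¹ ≤ ((n : ℝ) ^ c)⁻¹ := by
  -- The summand `1` keeps the constant positive when `c = 0`.
  filter_upwards [h.bound (c := ((c : ℝ) + 1)⁻¹) (by positivity), Filter.eventually_ge_atTop 1]
    with n hn hn1
  have hn0 : (0 : ℝ) < n := by exact_mod_cast hn1
  have hlog : 0 ≤ Real.logb 2 n := Real.logb_nonneg one_lt_two (by exact_mod_cast hn1)
  rw [Real.norm_of_nonneg hlog, Real.norm_natCast, inv_mul_eq_div, le_div_iff₀ (by positivity)] at hn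
  refine inv_anti₀ (by positivity) ?_
  rw [← Real.rpow_natCast, ← Real.rpow_natCast, ← Real.logb_le_iff_le_rpow one_lt_two (by positivity),
    Real.logb_rpow_eq_mul_logb_of_pos hn0]
  nlinarith

theorem eventually_eval_le_pow (p : Polynomial ℝ) :
    ∃ d : ℕ, ∀ᶠ n : ℕ in Filter.atTop, p.eval (n : ℝ) ≤ (n : ℝ) ^ d := by
  have h := p.isBigO_atTop_of_degree_le (Polynomial.X ^ p.natDegree)
    (by rw [Polynomial.degree_X_pow]; exact Polynomial.degree_le_natDegree)
  obtain ⟨c, hc⟩ := (h.comp_tendsto tendsto_natCast_atTop_atTop).bound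
  refine ⟨p.natDegree + 1, ?_⟩
  filter_upwards [hc, Filter.eventually_ge_atTop ⌈c⌉₊] with n hn hn'
  simp only [Function.comp_apply, Polynomial.eval_pow, Polynomial.eval_X, norm_pow,
    Real.norm_natCast] at hn
  rw [pow_succ']
  exact (le_abs_self _).trans (hn.trans (mul_le_mul_of_nonneg_right (Nat.ceil_le.1 hn')
    (by positivity)))

theorem Negligible.of_le_eval_mul {ℓ : ℕ → ℕ} {f g : ℕ → ℝ} {p : Polynomial ℝ}
    (h : ∀ᶠ n : ℕ in Filter.atTop, f n ≤ p.eval (n : ℝ) * (((2 : ℝ) ^ ℓ n)⁻¹ + g n))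
    (hg₀ : ∀ n, 0 ≤ g n) (hg : Negligible g)
    (hℓ : (fun n : ℕ => Real.logb 2 (n : ℝ)) =o[Filter.atTop] fun n : ℕ => (ℓ n : ℝ)) :
    Negligible f := by
  intro c
  obtain ⟨d, hd⟩ := eventually_eval_le_pow p
  -- The exponent `d` absorbs the polynomial, and the extra `1` absorbs the factor `2` from adding
  -- two equal bounds.
  filter_upwards [h, hd, hg (c + d + 1), eventually_inv_two_pow_le hℓ (c + d + 1),
    Filter.eventually_ge_atTop 2] with n h₁ h₂ h₃ h₄ hn
  have hn2 : (2 : ℝ) ≤ n := by exact_mod_cast hn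
  have hn0 : (0 : ℝ) < n := by linarith
  calc f n ≤ p.eval (n : ℝ) * (((2 : ℝ) ^ ℓ n)⁻¹ + g n) := h₁
    _ ≤ (n : ℝ) ^ d * (((2 : ℝ) ^ ℓ n)⁻¹ + g n) :=
      mul_le_mul_of_nonneg_right h₂ (add_nonneg (by positivity) (hg₀ n))
    _ ≤ (n : ℝ) ^ d * (((n : ℝ) ^ (c + d + 1))⁻¹ + ((n : ℝ) ^ (c + d + 1))⁻¹) := by gcongr
    _ = ((n : ℝ) ^ c)⁻¹ * (2 / n) := by field_simp; ring
    _ ≤ ((n : ℝ) ^ c)⁻¹ :=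
      mul_le_of_le_one_right (by positivity) ((div_le_one hn0).2 hn2)

end QCirc

end

/-! ### The main theorem -/

theorem mainTheorem3 :
    (∀ (ℓ : ℕ → ℕ) (s : ∀ n, QCirc.Bits (ℓ n)), QCirc.ComputablyIngenerable s →
      ∀ (G : QCirc.GateSet) (C : ∀ n, QCirc.Circuit G (ℓ n) 1), QCirc.IsUniform C →
        (∃ p : Polynomial ℝ, ∀ᶠ n : ℕ in Filter.atTop,
          QCirc.acceptProb (C n) (s n) ≤
            p.eval (n : ℝ) * (((2 : ℝ) ^ ℓ n)⁻¹ + QCirc.avgAcceptProb (C n))) ∧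
        (((fun n : ℕ => Real.logb 2 (n : ℝ)) =o[Filter.atTop] fun n : ℕ => (ℓ n : ℝ)) →
          QCirc.Negligible (fun n => QCirc.avgAcceptProb (C n)) →
          QCirc.Negligible (fun n => QCirc.acceptProb (C n) (s n)))) ∧
    (∀ (ℓ : ℕ → ℕ) (s : ∀ n, QCirc.Bits (ℓ n)),
      (∃ k : ℕ, (fun n : ℕ => (ℓ n : ℝ)) =O[Filter.atTop] fun n : ℕ => (n : ℝ) ^ k) →
      QCirc.ExpTimeIngenerable s →
      ∀ (G : QCirc.GateSet) (C : ∀ n, QCirc.Circuit G (ℓ n) 1), QCirc.IsExpTime C →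
        (∃ p : Polynomial ℝ, ∀ᶠ n : ℕ in Filter.atTop,
          QCirc.acceptProb (C n) (s n) ≤
            p.eval (n : ℝ) * (((2 : ℝ) ^ ℓ n)⁻¹ + QCirc.avgAcceptProb (C n))) ∧
        (((fun n : ℕ => Real.logb 2 (n : ℝ)) =o[Filter.atTop] fun n : ℕ => (ℓ n : ℝ)) →
          QCirc.Negligible (fun n => QCirc.avgAcceptProb (C n)) →
          QCirc.Negligible (fun n => QCirc.acceptProb (C n) (s n)))) := by
  refine ⟨fun ℓ s hs G C hC => ?_, fun ℓ s ⟨k, hℓ⟩ hs G C hC => ?_⟩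
  · obtain ⟨D, hD⟩ := QCirc.exists_sampleCircuit C
    -- The extended gate set depends only on `G`, so the polynomial is independent of the circuit
    -- family.
    obtain ⟨p, hp⟩ := hs (QCirc.extGates G)
    have h := (hp D (hC.sample hD)).mono fun n hn =>
      QCirc.acceptProb_le_of_prob_lt (C n) (D n) (hD n) (s n) hn
    exact ⟨⟨p, h⟩, fun hω havg => QCirc.Negligible.of_le_eval_mul h
      (fun n => QCirc.avgAcceptProb_nonneg (C n)) havg hω⟩
  · obtain ⟨D, hD⟩ := QCirc.exists_sampleCircuit C
    obtain ⟨p, hp⟩ := hs (QCirc.extGates G)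
    have h := (hp D (hC.sample hℓ hD)).mono fun n hn =>
      QCirc.acceptProb_le_of_prob_lt (C n) (D n) (hD n) (s n) hn
    exact ⟨⟨p, h⟩, fun hω havg => QCirc.Negligible.of_le_eval_mul h
      (fun n => QCirc.avgAcceptProb_nonneg (C n)) havg hω⟩
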